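/- Let $\mathbb{F}_q$ be a finite field, let $r\ge 1$, $\delta\ge 2$, $1\le \ell\le m$ be integers, and put $$n_L=r+\delta-1,\quad \alpha=d=n_L-1,\quad \beta=1,\quad K_L=r\alpha-\binom r2,\quad N_L=\binom{n_L}{2},\quad \Delta_L=N_L-K_L+1 .$$ **Definitions.** A linear code of length $n$ has symbols in $\mathbb{F}_q$ (scalar code) or in $\mathbb{F}_q^{\alpha}$ (vector code; each symbol is required to take all values in $\mathbb{F}_q^\alpha$). Its dimension is taken over $\mathbb{F}_q$, its minimum distance $d_{\min}$ counts differing symbols, and $\mathcal C|_S$ is $\mathcal C$ punctured to the coordinates in $S$. A code has $(\rho,\Delta)$ all-symbol locality if its coordinates are covered by sets $S$ (the supports of its local codes $\mathcal{C}|_S$) with $|S|\le \rho+\Delta-1$ and $d_{\min}(\mathcal C|_S)\ge \Delta$; the locality is exact if equality holds in both. (Here $\Delta=1$ is allowed, which for $\Delta=\Delta_L$ occurs exactly when $\delta=2$.) A scalar code of length $N$ and dimension $k\geq 1$ with this locality is optimal if $d_{\min}=N-k+1-(\lceil k/\rho\rceil-1)(\Delta-1)$. An $((n,k,d),(\alpha,\beta),B)$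 MBR code is a linear vector code over $\mathbb{F}_q^\alpha$ of length $n$ and dimension $B$, with $1\le k\le d<n$ and $\beta\le\alpha$, such that any $k$ nodes (symbols) determine the codeword; any node can be recovered exactly, by linear maps, from $\beta$ scalars downloaded from each of any $d$ other nodes; $B=\sum_{i=0}^{k-1}\min\{\alpha,(d-i)\beta\}$; $B$ exceeds this sum as soon as $\alpha$ or $\beta$ is reduced; and $\alpha=d\beta$. The repair-by-transfer (RBT) code built on a scalar code of length $N_L$ places its $N_L$ symbols on the edges of the complete graph on $n_L$ nodes, and each node stores the $\alpha$ symbols on its incident edges. **Theorem.** Let $\mathcal A$ be a scalar code over $\mathbb{F}_q$ of length $mN_L$ and dimension $\ell K_L$ that has $(K_L,\Delta_L)$ all-symbol locality and is optimal. Then the coordinates of $\mathcal A$ can be partitioned into $m$ pairwise disjoint supports $S_1,\dots,S_m$ of $(K_L,\Delta_L)$ local codes, and for every such partition each $\mathcal A|_{S_i}$ is an $[N_L,K_L,\Delta_L]$ MDS code. Let $\mathcal C$ be the vector code over $\mathbb{F}_q^\alpha$ obtained by building, for each $i$, an RBT code on $\mathcal A|_{S_i}$ (with any assignment of the symbols in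 $S_i$ to the edges of the $i$-th complete graph). Then $\mathcal C$ is an MBR-local code with exact $(r,\delta)$ all-symbol locality, composed of $m$ support-disjoint local codes (the $m$ groups of $n_L$ nodes), each of which is a repair-by-transfer $((n_L,r,d),(\alpha,\beta),K_L)$ MBR code, i.e. an MBR code with these parameters that is the RBT code of an $[N_L,K_L,\Delta_L]$ MDS code. The code $\mathcal C$ has length $n=mn_L$, dimension $K=\ell K_L$, and $$d_{\min}(\mathcal C)=n-\frac{K}{K_L}\,r+1-\Big(\frac{K}{K_L}-1\Big)(\delta-1)=(m-\ell)n_L+\delta .$$ Moreover the local codes have uniform rank accumulation: any $s\le n_L$ nodes of a group carry $a_1+\dots+a_s$ linearly independent scalars, where $a_i=\alpha-i+1$ for $i\le r$ and $a_i=0$ for $r<i\le n_L$. The code $\mathcal C$ meets the corresponding bound (URA bound) with equality: $d_{\min}(\mathcal C)=n-P^{(\mathrm{inv})}(K)+1$, where $P^{(\mathrm{inv})}(K)$ is the least $s$ with $\sum_{i=1}^s a_i\ge K$ and $(a_i)$ is extended with period $n_L$. -/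

import Mathlib

/-! Codes of finite block length. The coordinates are indexed by a finite type `ι`, the symbol
alphabet is an `F`-module `V`: `V = F` for scalar codes, `V = Fin α → F` for vector codes. -/

namespace LocalCodes

open Module

section Basic

variable {F V ι κ : Type*} [Field F] [AddCommGroup V] [Module F V] [Fintype ι]

open Classical in
/-- Minimum distance: the least Hamming distance (number of differing symbols) between two distinct
codewords. It is `⊤` exactly for the zero code. -/
noncomputable def minDist (C : Submodule F (ι → V)) : ℕ∞ :=
  ⨅ c ∈ C, ⨅ c' ∈ C, ⨅ (_ : c ≠ c'), (hammingDist c c' : ℕ∞)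

/-- The code `C` punctured to the set `S` of coordinates (the restriction `C|_S`).
For a generator matrix `G` of `C`, the restriction `G|_S` has row space `C|_S`, so that
`rank (G|_S)` is the dimension of `puncture C S`. -/
def puncture (C : Submodule F (ι → V)) (S : Finset ι) : Submodule F (S → V) :=
  C.map (LinearMap.funLeft F V (fun x : S => (x : ι)))

/-- The code `C` of block length `N` is an `[N, k, N - k + 1]` (MDS) code. -/
def IsMDS (C : Submodule F (ι → F)) (k : ℕ) : Prop :=
  finrank F C = k ∧ minDist C + k = Fintype.card ι + 1

/-- `(r, δ)` information locality, with local codes supported on the sets `S i`. -/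
structure HasInfoLocality [Fintype κ] [DecidableEq ι] (C : Submodule F (ι → V)) (r δ : ℕ)
    (S : κ → Finset ι) : Prop where
  card_le : ∀ i, (S i).card ≤ r + δ - 1
  le_minDist : ∀ i, (δ : ℕ∞) ≤ minDist (puncture C (S i))
  rank_eq : finrank F (puncture C (Finset.univ.biUnion S)) = finrank F C

/-- Exact `(r, δ)` information locality, with local codes supported on the sets `S i`. -/
structure HasExactInfoLocality [Fintype κ] [DecidableEq ι] (C : Submodule F (ι → V)) (r δ : ℕ)
    (S : κ → Finset ι) : Prop where
  card_eq : ∀ i, (S i).card = r + δ - 1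
  minDist_eq : ∀ i, minDist (puncture C (S i)) = δ
  rank_eq : finrank F (puncture C (Finset.univ.biUnion S)) = finrank F C

/-- `(r, δ)` all-symbol locality, with local codes supported on the sets `S i`. -/
def HasAllSymbolLocality [Fintype κ] [DecidableEq ι] (C : Submodule F (ι → V)) (r δ : ℕ)
    (S : κ → Finset ι) : Prop :=
  HasInfoLocality C r δ S ∧ Finset.univ.biUnion S = Finset.univ

/-- A scalar code `C` of length `n` and dimension `k` that has `(r, δ)` all-symbol locality and is
optimal: `d_min = n - k + 1 - (⌈k / r⌉ - 1) (δ - 1)`. -/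
def IsOptimalAllSymbol [DecidableEq ι] (C : Submodule F (ι → F)) (r δ : ℕ) : Prop :=
  (∃ (t : ℕ) (S : Fin t → Finset ι), HasAllSymbolLocality C r δ S) ∧
  ∃ d : ℕ, minDist C = d ∧
    (d : ℤ) = (Fintype.card ι : ℤ) - finrank F C + 1
      - (⌈(finrank F C : ℚ) / (r : ℚ)⌉ - 1) * ((δ : ℤ) - 1)

end Basic

section VectorCodes

variable {F ι κ : Type*} [Field F] [Fintype ι] {α : ℕ}

/-- The standing requirement on vector codes over `F ^ α`: every code symbol takes all values in
`F ^ α`, i.e. the `α` thin columns of each thick column are linearly independent. -/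
def IsVectorCode (C : Submodule F (ι → Fin α → F)) : Prop :=
  ∀ (i : ι) (v : Fin α → F), ∃ c ∈ C, c i = v

/-- The right-hand side of the cut-set bound, `∑_{i < k} min {α, (d - i) β}`. -/
def cutSet (k d α β : ℕ) : ℕ := ∑ i ∈ Finset.range k, min α ((d - i) * β)

/-- `C` is a linear exact-repair regenerating code with parameters `((n, k, d), (α, β), B)`. -/
structure IsRegenerating (C : Submodule F (ι → Fin α → F)) (n k d β B : ℕ) : Prop where
  length : Fintype.card ι = n
  one_le : 1 ≤ k
  le : k ≤ d
  lt : d < n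
  beta_le : β ≤ α
  fileSize : finrank F C = B
  vectorCode : IsVectorCode C
  /-- data collection: the contents of any `k` nodes determine the codeword -/
  collect : ∀ T : Finset ι, T.card = k → ∀ c ∈ C, ∀ c' ∈ C, (∀ i ∈ T, c i = c' i) → c = c'
  /-- node repair: any node is recovered exactly by downloading `β` symbols from each of any `d`
  other nodes -/
  repair : ∀ (f : ι) (D : Finset ι), f ∉ D → D.card = d →
    ∃ (g : D → (Fin α → F) →ₗ[F] (Fin β → F)) (R : (D → Fin β → F) →ₗ[F] (Fin α → F)),
      ∀ c ∈ C, c f = R (fun h => g h (c h))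

/-- `C` is an `((n, k, d), (α, β), B)` MBR code: an exact-repair regenerating code that attains the
cut-set bound, violates it as soon as `α` or `β` is reduced, and has `α = d β`. -/
structure IsMBR (C : Submodule F (ι → Fin α → F)) (n k d β B : ℕ) : Prop where
  regenerating : IsRegenerating C n k d β B
  cutSet_eq : B = cutSet k d α β
  alpha_opt : ∀ α' < α, cutSet k d α' β < B
  beta_opt : ∀ β' < β, cutSet k d α β' < B
  alpha_eq : α = d * β

/-- `C` is an MBR-local code with `(r, δ)` all-symbol locality whose local codes are the
`((r + δ - 1, r, d), (α, β), B)` MBR codes supported on the sets `S i`. -/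
structure IsMBRLocalAllSymbol [Fintype κ] [DecidableEq ι] (C : Submodule F (ι → Fin α → F))
    (r δ d β B : ℕ) (S : κ → Finset ι) : Prop where
  vectorCode : IsVectorCode C
  exactLocality : HasExactInfoLocality C r δ S
  localMBR : ∀ i, IsMBR (puncture C (S i)) (r + δ - 1) r d β B
  allSymbol : Finset.univ.biUnion S = Finset.univ

/-- Uniform rank accumulation with profile `a` (with `a j` standing for `a_{j+1}`): any `s` thick
columns of a generator matrix have rank `a_1 + ⋯ + a_s`. -/
def IsURA (C : Submodule F (ι → Fin α → F)) (a : ℕ → ℕ) : Prop :=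
  ∀ T : Finset ι, finrank F (puncture C T) = ∑ j ∈ Finset.range T.card, a j

/-- The leading-sum function `P` of the periodic extension, of period `nL`, of `a_1, …, a_{nL}`
(with `a j` standing for `a_{j+1}`). -/
def leadingSum (a : ℕ → ℕ) (nL s : ℕ) : ℕ := ∑ j ∈ Finset.range s, a (j % nL)

/-- `P^(inv) ν`: the least `s` with `P s ≥ ν`. -/
noncomputable def leadingSumInv (a : ℕ → ℕ) (nL ν : ℕ) : ℕ := sInf {s | ν ≤ leadingSum a nL s}

/-- `C` has exact `(r, δ)` information locality with URA local codes of profile `a`, supported on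
the sets `S i`, and meets the URA bound `d_min ≤ n - P^(inv)(K) + 1` with equality. -/
structure MeetsURABound [Fintype κ] [DecidableEq ι] (C : Submodule F (ι → Fin α → F))
    (r δ : ℕ) (a : ℕ → ℕ) (S : κ → Finset ι) : Prop where
  exactLocality : HasExactInfoLocality C r δ S
  localURA : ∀ i, IsURA (puncture C (S i)) a
  minDist_eq : ∃ d : ℕ, minDist C = d ∧
    (d : ℤ) = (Fintype.card ι : ℤ) - leadingSumInv a (r + δ - 1) (finrank F C) + 1

end VectorCodes

section RepairByTransfer

variable {F : Type*} [Field F]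

/-- The edges of the complete graph on `n_L = α + 1` nodes. -/
abbrev Edge (α : ℕ) : Type := (⊤ : SimpleGraph (Fin (α + 1))).edgeSet

/-- The edge joining the node `v` to its `j`-th neighbour; `Fin.succAbove v` enumerates the nodes
different from `v`. -/
def edge {α : ℕ} (v : Fin (α + 1)) (j : Fin α) : Edge α :=
  ⟨s(v, v.succAbove j), by
    rw [SimpleGraph.mem_edgeSet, SimpleGraph.top_adj]
    exact (Fin.succAbove_ne v j).symm⟩

/-- Repair-by-transfer placement: scalar symbols are put on the edges of the complete graph on
`α + 1` nodes, and a node stores the `α` symbols of its incident edges. -/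
def rbtMap (F : Type*) [Field F] (α : ℕ) :
    (Edge α → F) →ₗ[F] (Fin (α + 1) → Fin α → F) where
  toFun x := fun v j => x (edge v j)
  map_add' _ _ := rfl
  map_smul' _ _ := rfl

/-- `K_L = r α - binom(r, 2)`. -/
def localDim (α r : ℕ) : ℕ := r * α - r.choose 2

/-- `N_L = binom(n_L, 2)` with `n_L = α + 1`. -/
def localScalarLength (α : ℕ) : ℕ := (α + 1).choose 2

/-- `Δ_L = N_L - K_L + 1`. -/
def localScalarDist (α r : ℕ) : ℕ := localScalarLength α - localDim α r + 1

/-- The rank accumulation profile of an MBR code: `a_i = α - i + 1` for `1 ≤ i ≤ r` and `a_i = 0`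
for `i > r` (the value at `j` is `a_{j+1}`). -/
def mbrProfile (α r : ℕ) (j : ℕ) : ℕ := if j < r then α - j else 0

/-- A vector code on `α + 1` nodes is a repair-by-transfer code with reconstruction degree `r` if,
up to naming the nodes, it is obtained by repair-by-transfer placement from an MDS code of length
`N_L` and dimension `K_L`. -/
def IsRBT {κ : Type*} {α : ℕ} (C : Submodule F (κ → Fin α → F)) (r : ℕ) : Prop :=
  ∃ (σ : κ ≃ Fin (α + 1)) (B : Submodule F (Edge α → F)),
    IsMDS B (localDim α r) ∧
    C = (B.map (rbtMap F α)).map (LinearMap.funLeft F (Fin α → F) σ)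

/-- The sets `S i` are supports of `(r, δ)` local codes of `A`, pairwise disjoint and covering all
the coordinates. -/
structure IsLocalPartition {ι κ : Type*} [Fintype ι] [DecidableEq ι] [Fintype κ]
    (A : Submodule F (ι → F)) (r δ : ℕ) (S : κ → Finset ι) : Prop where
  locality : HasAllSymbolLocality A r δ S
  disjoint : ∀ i j, i ≠ j → Disjoint (S i) (S j)

/-- The vector code obtained from a scalar code `A` by repair-by-transfer placement on each of its
local codes: for every `i` the scalar symbols of `A` in `S i` are put, according to `e i`, on the
edges of the `i`-th complete graph on `α + 1` nodes. The node `v` of the `i`-th graph has index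
`(i, v)`. -/
def rbtConstruction {ι : Type*} {α m : ℕ} (A : Submodule F (ι → F)) (S : Fin m → Finset ι)
    (e : ∀ i, Edge α ≃ S i) : Submodule F (Fin m × Fin (α + 1) → Fin α → F) :=
  A.map
    ({ toFun := fun a p => rbtMap F α (fun x => a (e p.1 x)) p.2
       map_add' := fun _ _ => rfl
       map_smul' := fun _ _ => rfl } :
      (ι → F) →ₗ[F] (Fin m × Fin (α + 1) → Fin α → F))

/-- The nodes of the `i`-th complete graph. -/
def nodeGroup (α m : ℕ) (i : Fin m) : Finset (Fin m × Fin (α + 1)) :=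
  {i} ×ˢ Finset.univ

end RepairByTransfer

end LocalCodes

/-! Write `ℓ = l + 1`, `K = K_L`, `E = Δ_L - 1`, so `N_L = K + E`. The rank of a set `U` of
coordinates is the dimension of `puncture A U`, and its nullity is `|U|` minus the rank.

Structure of `A`. Optimality makes any `l (K + E) + K` coordinates determine a codeword
(`eq_zero_of_isOptimal`), so a set of rank below `(l + 1) K` has nullity at most `l E`. Adjoining a
local code that raises the rank raises it by at most `K` and raises the nullity by at least `E`.
Descending from `l`, rank below `(j + 1) K` forces nullity at most `j E`
(`card_le_of_finrank_lt_mul`). The case `j = 0` makes local codes full-sized and MDS, and `j = 1`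
makes distinct ones disjoint; when `l = 0` or `E = 0`, any partition into blocks of size `N_L`
works.

One group. Vanishing on `s` nodes means vanishing on the edges incident to them, of which there are
`α + (α - 1) + ⋯` (`s` terms). Since the scalar code is MDS, ranks depend only on this count
(`finrank_puncture_rbtCode`); rank accumulation, local distance and data collection follow. For
repair, any two nodes share an edge.

Global distance. If `u i` nodes of group `i` are unknown, `(u i).choose 2` scalars of that group are
unknown. By convexity the worst pattern loses `m - ℓ` whole groups and `δ - 1` further nodes
(`sum_choose_two_le`), which leaves exactly enough scalars to determine the codeword. Conversely, `ℓ
- 1` groups with `r - 1` further nodes do not have full rank. -/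

namespace LocalCodes

open Module

/-! ### Minimum distance as determination by coordinates -/

section Distance

variable {F V ι : Type*} [Field F] [AddCommGroup V] [Module F V]

/-- By linearity distances are weights, and a weight below `D` means more than `n - D` zeros. This
form, free of subtraction and of `ℕ∞`, is how distance is used in the rank arguments below. -/
theorem le_minDist_iff [Fintype ι] (C : Submodule F (ι → V)) (D : ℕ) :
    (D : ℕ∞) ≤ minDist C ↔ ∀ c ∈ C, ∀ T : Finset ι, Fintype.card ι < T.card + D →
      (∀ i ∈ T, c i = 0) → c = 0 := by
  classical
  simp only [minDist, le_iInf_iff, Nat.cast_le]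
  constructor
  · intro h c hc T hT hz
    by_contra hne
    have h1 := h c hc 0 C.zero_mem hne
    have h2 : hammingDist c 0 ≤ Tᶜ.card := by
      unfold hammingDist
      refine Finset.card_le_card fun i hi => ?_
      simp only [Finset.mem_filter, Pi.zero_apply] at hi
      exact Finset.mem_compl.2 fun hiT => hi.2 (hz i hiT)
    have h3 := Finset.card_compl_add_card T
    have h4 : hammingDist c 0 = @hammingDist ι (fun _ => V) _
      (fun _ a b => Classical.propDecidable (a = b)) c 0 := by congr
    omega
  · intro h c hc c' hc' hne
    by_contra hlt
    refine hne (sub_eq_zero.1 (h (c - c') (C.sub_mem hc hc')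
      (Finset.univ.filter fun i => c i = c' i) ?_ ?_))
    · have h1 := Finset.card_filter_add_card_filter_not (s := (Finset.univ : Finset ι))
        (fun i => c i = c' i)
      rw [Finset.card_univ] at h1
      have h4 : (Finset.univ.filter fun i => ¬ c i = c' i).card < D := by
        refine lt_of_eq_of_lt ?_ (not_le.1 hlt)
        unfold hammingDist
        congr
      omega
    · intro i hi
      simpa [sub_eq_zero] using hi

theorem minDist_le_of_exists [Fintype ι] {C : Submodule F (ι → V)} {D : ℕ} {c : ι → V} (hc : c ∈ C)
    (hne : c ≠ 0) (T : Finset ι) (hT : Fintype.card ι ≤ T.card + D) (hz : ∀ i ∈ T, c i = 0) :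
    minDist C ≤ D := by
  by_contra h
  have h1 : ((D + 1 : ℕ) : ℕ∞) ≤ minDist C := by
    push_cast
    exact Order.add_one_le_of_lt (not_le.1 h)
  exact hne ((le_minDist_iff C (D + 1)).1 h1 c hc T (by omega) hz)

theorem le_minDist_puncture_iff (C : Submodule F (ι → V)) (S : Finset ι) (D : ℕ) :
    (D : ℕ∞) ≤ minDist (puncture C S) ↔ ∀ c ∈ C, ∀ T ⊆ S, S.card < T.card + D →
      (∀ i ∈ T, c i = 0) → ∀ i ∈ S, c i = 0 := by
  classical
  rw [le_minDist_iff, Fintype.card_coe]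
  constructor
  · intro h c hc T hTS hT hz i hi
    have h1 : (T.subtype (· ∈ S)).card = T.card := by
      rw [Finset.card_subtype, Finset.filter_true_of_mem fun x hx => hTS hx]
    exact congrFun (h (fun i : S => c i) ⟨c, hc, rfl⟩ (T.subtype (· ∈ S)) (by omega)
      fun j hj => hz j (Finset.mem_subtype.1 hj)) ⟨i, hi⟩
  · rintro h x ⟨c, hc, rfl⟩ T hT hz
    funext i
    refine h c hc (T.map (Function.Embedding.subtype _)) ?_ (by simpa using hT) ?_ i i.2
    · intro j hj
      obtain ⟨y, -, rfl⟩ := Finset.mem_map.1 hj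
      exact y.2
    · intro j hj
      obtain ⟨y, hy, rfl⟩ := Finset.mem_map.1 hj
      exact hz y hy

theorem le_minDist_map_funLeft [Fintype ι] {κ : Type*} [Fintype κ] {C : Submodule F (ι → V)} (σ : κ ≃ ι)
    {D : ℕ} (h : (D : ℕ∞) ≤ minDist C) :
    (D : ℕ∞) ≤ minDist (C.map (LinearMap.funLeft F V σ)) := by
  rw [le_minDist_iff] at h ⊢
  rintro x ⟨c, hc, rfl⟩ T hT hz
  have : c = 0 := by
    refine h c hc (T.map σ.toEmbedding) (by rw [Finset.card_map, ← Fintype.card_congr σ]; exact hT)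
      fun i hi => ?_
    obtain ⟨y, hy, rfl⟩ := Finset.mem_map.1 hi
    exact hz y hy
  rw [this, map_zero]

theorem minDist_map_funLeft [Fintype ι] {κ : Type*} [Fintype κ] (C : Submodule F (ι → V)) (σ : κ ≃ ι) :
    minDist (C.map (LinearMap.funLeft F V σ)) = minDist C := by
  refine le_antisymm (ENat.forall_natCast_le_iff_le.1 fun D hD => ?_)
    (ENat.forall_natCast_le_iff_le.1 fun D hD => le_minDist_map_funLeft σ hD)
  have h := le_minDist_map_funLeft σ.symm hD
  rw [← Submodule.map_comp, ← LinearMap.funLeft_comp] at h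
  rwa [Equiv.self_comp_symm, show LinearMap.funLeft F V (id : ι → ι) = LinearMap.id from rfl,
    Submodule.map_id] at h

end Distance

/-! ### Ranks of coordinate sets -/

section Rank

variable {F : Type*} [Field F]

/-- Rank–nullity on `A`: the larger kernel has the smaller image. It turns comparisons of ranks into
implications between vanishing conditions. -/
theorem finrank_map_le_of_ker {M M₁ M₂ : Type*} [AddCommGroup M] [Module F M] [AddCommGroup M₁]
    [Module F M₁] [AddCommGroup M₂] [Module F M₂] [FiniteDimensional F M] (A : Submodule F M)
    (f : M →ₗ[F] M₁) (g : M →ₗ[F] M₂) (h : ∀ a ∈ A, g a = 0 → f a = 0) :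
    finrank F (A.map f) ≤ finrank F (A.map g) := by
  have hf := LinearMap.finrank_range_add_finrank_ker (f.domRestrict A)
  have hg := LinearMap.finrank_range_add_finrank_ker (g.domRestrict A)
  have hle : LinearMap.ker (g.domRestrict A) ≤ LinearMap.ker (f.domRestrict A) := fun a ha =>
    h a a.2 ha
  have := Submodule.finrank_mono hle
  rw [LinearMap.range_domRestrict] at hf hg
  omega

theorem finrank_map_eq_of_ker {M M₁ M₂ : Type*} [AddCommGroup M] [Module F M] [AddCommGroup M₁]
    [Module F M₁] [AddCommGroup M₂] [Module F M₂] [FiniteDimensional F M] (A : Submodule F M)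
    (f : M →ₗ[F] M₁) (g : M →ₗ[F] M₂) (h : ∀ a ∈ A, f a = 0 ↔ g a = 0) :
    finrank F (A.map f) = finrank F (A.map g) :=
  le_antisymm (finrank_map_le_of_ker A f g fun a ha => (h a ha).2)
    (finrank_map_le_of_ker A g f fun a ha => (h a ha).1)

theorem finrank_map_eq_self {M M₁ : Type*} [AddCommGroup M] [Module F M] [AddCommGroup M₁]
    [Module F M₁] [FiniteDimensional F M] (A : Submodule F M)
    (f : M →ₗ[F] M₁) (h : ∀ a ∈ A, f a = 0 → a = 0) : finrank F (A.map f) = finrank F A := by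
  rw [finrank_map_eq_of_ker A f LinearMap.id fun a ha => ⟨h a ha, fun h0 => ?_⟩, Submodule.map_id]
  rw [LinearMap.id_apply] at h0
  rw [h0, map_zero]

variable {ι : Type*}

theorem restrict_eq_zero_iff {V : Type*} [AddCommGroup V] [Module F V] (S : Finset ι) (a : ι → V) :
    LinearMap.funLeft F V (fun x : S => (x : ι)) a = 0 ↔ ∀ i ∈ S, a i = 0 :=
  ⟨fun h i hi => congrFun h ⟨i, hi⟩, fun h => funext fun x => h x x.2⟩

theorem puncture_finrank_le [Fintype ι] (A : Submodule F (ι → F)) {T U : Finset ι}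
    (h : ∀ a ∈ A, (∀ i ∈ U, a i = 0) → ∀ i ∈ T, a i = 0) :
    finrank F (puncture A T) ≤ finrank F (puncture A U) :=
  finrank_map_le_of_ker A _ _ fun a ha h0 =>
    (restrict_eq_zero_iff T a).2 (h a ha ((restrict_eq_zero_iff U a).1 h0))

theorem puncture_finrank_eq_self [Fintype ι] (A : Submodule F (ι → F)) {T : Finset ι}
    (h : ∀ a ∈ A, (∀ i ∈ T, a i = 0) → a = 0) :
    finrank F (puncture A T) = finrank F A :=
  finrank_map_eq_self A _ fun a ha h0 => h a ha ((restrict_eq_zero_iff T a).1 h0)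

theorem puncture_finrank_le_card (A : Submodule F (ι → F)) (T : Finset ι) :
    finrank F (puncture A T) ≤ T.card := by
  simpa using Submodule.finrank_le (puncture A T)

theorem puncture_finrank_union_le [Fintype ι] [DecidableEq ι] (A : Submodule F (ι → F)) (U X : Finset ι) :
    finrank F (puncture A (U ∪ X)) ≤ finrank F (puncture A U) + X.card := by
  let f := (LinearMap.funLeft F F (fun x : U => (x : ι))).prod
    (LinearMap.funLeft F F (fun x : X => (x : ι)))
  have h1 : finrank F (puncture A (U ∪ X)) ≤ finrank F (A.map f) := by
    refine finrank_map_le_of_ker A _ _ fun a ha h0 => ?_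
    have h2 := Prod.ext_iff.1 h0
    rw [restrict_eq_zero_iff]
    intro i hi
    rcases Finset.mem_union.1 hi with hi | hi
    · exact (restrict_eq_zero_iff (F := F) U a).1 h2.1 i hi
    · exact (restrict_eq_zero_iff (F := F) X a).1 h2.2 i hi
  let g := (puncture A U).subtype.prodMap (LinearMap.id : (X → F) →ₗ[F] (X → F))
  have h2 : A.map f ≤ LinearMap.range g := by
    rintro _ ⟨a, ha, rfl⟩
    exact ⟨⟨⟨_, a, ha, rfl⟩, fun x => a x⟩, rfl⟩
  have h3 := Submodule.finrank_mono h2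
  have h4 := LinearMap.finrank_range_le g
  rw [Module.finrank_prod, Module.finrank_fintype_fun_eq_card, Fintype.card_coe] at h4
  omega

theorem exists_of_puncture_finrank_lt [Fintype ι] {A : Submodule F (ι → F)} {T U : Finset ι}
    (h : finrank F (puncture A T) < finrank F (puncture A U)) :
    ∃ a ∈ A, (∀ i ∈ T, a i = 0) ∧ ∃ i ∈ U, a i ≠ 0 := by
  by_contra hcon
  push Not at hcon
  exact absurd (puncture_finrank_le A hcon) (not_le.2 h)

theorem puncture_finrank_lt [Fintype ι] {A : Submodule F (ι → F)} {T U : Finset ι} (h : T ⊆ U)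
    {a : ι → F} (ha : a ∈ A) (hT : ∀ i ∈ T, a i = 0) {i : ι} (hi : i ∈ U) (hai : a i ≠ 0) :
    finrank F (puncture A T) < finrank F (puncture A U) := by
  have hf := LinearMap.finrank_range_add_finrank_ker
    ((LinearMap.funLeft F F (fun x : T => (x : ι))).domRestrict A)
  have hg := LinearMap.finrank_range_add_finrank_ker
    ((LinearMap.funLeft F F (fun x : U => (x : ι))).domRestrict A)
  have hlt : LinearMap.ker ((LinearMap.funLeft F F (fun x : U => (x : ι))).domRestrict A) <
      LinearMap.ker ((LinearMap.funLeft F F (fun x : T => (x : ι))).domRestrict A) := by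
    refine lt_of_le_of_ne (fun b hb => (restrict_eq_zero_iff (F := F) T (b : ι → F)).2 fun j hj =>
      (restrict_eq_zero_iff (F := F) U (b : ι → F)).1 hb j (h hj)) fun heq => hai ?_
    have h1 : (⟨a, ha⟩ : A) ∈
        LinearMap.ker ((LinearMap.funLeft F F (fun x : T => (x : ι))).domRestrict A) :=
      (restrict_eq_zero_iff (F := F) T a).2 hT
    rw [← heq] at h1
    exact (restrict_eq_zero_iff (F := F) U a).1 h1 i hi
  have := Submodule.finrank_lt_finrank_of_lt hlt
  rw [LinearMap.range_domRestrict] at hf hg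
  unfold puncture
  omega

end Rank

/-! ### Local codes of an optimal scalar code -/

section Structure

variable {F ι : Type*} [Field F] [Fintype ι]

/-- The local code corrects `E` erasures, so any `E` coordinates of `S \ U` can be dropped from `U ∪
S` without loss of rank. In other words, the nullity grows by at least `E`. -/
theorem finrank_union_add_le [DecidableEq ι] {A : Submodule F (ι → F)} {S U : Finset ι} {E : ℕ}
    (hS : ((E + 1 : ℕ) : ℕ∞) ≤ minDist (puncture A S))
    (hlt : finrank F (puncture A U) < finrank F (puncture A (U ∪ S))) :
    finrank F (puncture A (U ∪ S)) + E ≤ finrank F (puncture A U) + (S \ U).card := by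
  rw [le_minDist_puncture_iff] at hS
  have key : ∀ D ⊆ S \ U, D.card ≤ E →
      finrank F (puncture A (U ∪ S)) ≤ finrank F (puncture A (U ∪ (S \ U) \ D)) := by
    intro D hD hcard
    refine puncture_finrank_le A fun a ha h0 i hi => ?_
    rcases Finset.mem_union.1 hi with hi | hi
    · exact h0 i (Finset.mem_union_left _ hi)
    · refine hS a ha (S \ D) Finset.sdiff_subset ?_ (fun j hj => h0 j ?_) i hi
      · have := Finset.card_sdiff_add_card_eq_card (hD.trans Finset.sdiff_subset)
        omega
      · rw [Finset.mem_sdiff] at hj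
        by_cases hjU : j ∈ U
        · exact Finset.mem_union_left _ hjU
        · exact Finset.mem_union_right _
            (Finset.mem_sdiff.2 ⟨Finset.mem_sdiff.2 ⟨hj.1, hjU⟩, hj.2⟩)
  by_cases hE : E ≤ (S \ U).card
  · obtain ⟨D, hD, hDE⟩ := Finset.exists_subset_card_eq hE
    have h1 := key D hD hDE.le
    have h2 := puncture_finrank_union_le A U ((S \ U) \ D)
    have h3 := Finset.card_sdiff_add_card_eq_card hD
    omega
  -- With fewer than `E` new coordinates all of them can be dropped, so the rank could not have
  -- grown.
  · have h1 := key (S \ U) subset_rfl (by omega)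
    rw [Finset.sdiff_self, Finset.union_empty] at h1
    omega

theorem finrank_union_le_add [DecidableEq ι] {A : Submodule F (ι → F)} {S U : Finset ι} {K E : ℕ}
    (hcard : S.card ≤ K + E) (hS : ((E + 1 : ℕ) : ℕ∞) ≤ minDist (puncture A S)) :
    finrank F (puncture A (U ∪ S)) ≤ finrank F (puncture A U) + K := by
  by_cases hlt : finrank F (puncture A U) < finrank F (puncture A (U ∪ S))
  · have h1 := finrank_union_add_le hS hlt
    have h2 := Finset.card_le_card (Finset.sdiff_subset : S \ U ⊆ S)
    omega
  · omega

theorem finrank_le_of_local [DecidableEq ι] {A : Submodule F (ι → F)} {S : Finset ι} {K E : ℕ}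
    (hcard : S.card ≤ K + E) (hS : ((E + 1 : ℕ) : ℕ∞) ≤ minDist (puncture A S)) :
    finrank F (puncture A S) ≤ K := by
  have h := finrank_union_le_add (U := ∅) hcard hS
  have h0 := puncture_finrank_le_card A ∅
  rw [Finset.card_empty] at h0
  rw [Finset.empty_union] at h
  omega

theorem finrank_biUnion_le [DecidableEq ι] {κ : Type*} [DecidableEq κ] {A : Submodule F (ι → F)}
    (S : κ → Finset ι) {K E : ℕ}
    (hcard : ∀ i, (S i).card ≤ K + E)
    (hS : ∀ i, ((E + 1 : ℕ) : ℕ∞) ≤ minDist (puncture A (S i))) (I : Finset κ) :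
    finrank F (puncture A (I.biUnion S)) ≤ I.card * K := by
  induction I using Finset.induction_on with
  | empty =>
    rw [Finset.biUnion_empty, Finset.card_empty, zero_mul]
    exact puncture_finrank_le_card A ∅
  | insert x I hx ih =>
    rw [Finset.biUnion_insert, Finset.union_comm, Finset.card_insert_of_notMem hx, add_mul, one_mul]
    have := finrank_union_le_add (U := I.biUnion S) (hcard x) (hS x)
    omega

/-- In a code that is determined by any `l (K + E) + K` of its coordinates, a set of rank less
than the dimension has bounded nullity. -/
theorem card_le_of_finrank_lt [DecidableEq ι] {A : Submodule F (ι → F)} {K E l : ℕ}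
    (hdim : finrank F A = (l + 1) * K)
    (hdet : ∀ a ∈ A, ∀ T : Finset ι, l * (K + E) + K ≤ T.card → (∀ i ∈ T, a i = 0) → a = 0)
    {U : Finset ι} (hU : finrank F (puncture A U) < (l + 1) * K) :
    U.card ≤ finrank F (puncture A U) + l * E := by
  by_contra hcon
  have huniv : finrank F (puncture A Finset.univ) = (l + 1) * K := by
    rw [puncture_finrank_eq_self A fun a _ h => funext fun i => h i (Finset.mem_univ i), hdim]
  have hc := Finset.card_compl_add_card U
  -- Adding this many coordinates keeps the rank at most `(l + 1) K - 1`, while a nullity above `l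
  -- E` would bring the size up to `l (K + E) + K`, where the rank must be full.
  have hex : (l + 1) * K - 1 - finrank F (puncture A U) ≤ Uᶜ.card := by
    have h1 := puncture_finrank_union_le A U Uᶜ
    rw [Finset.union_compl] at h1
    omega
  obtain ⟨X, hX, hXc⟩ := Finset.exists_subset_card_eq hex
  have h1 := puncture_finrank_union_le A U X
  have h2 : (U ∪ X).card = U.card + X.card :=
    Finset.card_union_of_disjoint (Finset.disjoint_left.2 fun i hi hiX =>
      Finset.mem_compl.1 (hX hiX) hi)
  have h3 := puncture_finrank_eq_self (T := U ∪ X) A fun a ha h => hdet a ha _ (by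
    rw [mul_add]
    rw [add_mul, one_mul] at hXc hU
    omega) h
  omega

/-- Induction on `d = l - j`. Since `U` is not of full rank, some codeword vanishes on `U` but not
at some `i`; a local code through `i` raises the rank by at most `K` and the nullity by at least
`E`, so the bound for `j + 1` on the union gives the bound for `j` on `U`. -/
theorem card_le_of_finrank_lt_mul [DecidableEq ι] {A : Submodule F (ι → F)} {K E l : ℕ}
    (hdim : finrank F A = (l + 1) * K)
    (hdet : ∀ a ∈ A, ∀ T : Finset ι, l * (K + E) + K ≤ T.card → (∀ i ∈ T, a i = 0) → a = 0)
    (hloc : ∀ i, ∃ S : Finset ι, i ∈ S ∧ S.card ≤ K + E ∧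
      ((E + 1 : ℕ) : ℕ∞) ≤ minDist (puncture A S)) (d : ℕ) :
    ∀ (j : ℕ) (U : Finset ι), j + d = l → finrank F (puncture A U) < (j + 1) * K →
      U.card ≤ finrank F (puncture A U) + j * E := by
  induction d with
  | zero =>
    intro j U hj hU
    obtain rfl : j = l := hj
    exact card_le_of_finrank_lt hdim hdet hU
  | succ d ih =>
    intro j U hj hU
    have huniv : finrank F (puncture A Finset.univ) = (l + 1) * K := by
      rw [puncture_finrank_eq_self A fun a _ h => funext fun i => h i (Finset.mem_univ i), hdim]
    have hjl : (j + 1) * K ≤ (l + 1) * K := Nat.mul_le_mul_right K (by omega)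
    obtain ⟨a, ha, ha0, i, -, hi⟩ := exists_of_puncture_finrank_lt (T := U) (U := Finset.univ)
      (A := A) (by omega)
    obtain ⟨S, hiS, hcard, hS⟩ := hloc i
    have hlt := puncture_finrank_lt (Finset.subset_union_left (s₂ := S)) ha ha0
      (Finset.mem_union_right _ hiS) hi
    have h1 := finrank_union_add_le hS hlt
    have h2 := finrank_union_le_add (U := U) hcard hS
    have h3 := ih (j + 1) (U ∪ S) (by omega) (by rw [add_mul (j + 1), one_mul]; omega)
    have h4 := Finset.card_sdiff_add_card S U
    rw [Finset.union_comm S U] at h4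
    rw [add_mul, one_mul] at h3
    omega

/-- By the case `j = 0`, sets of rank below `K` have nullity zero. A nonempty local code has
positive rank, hence nullity at least `E ≥ 1`, so its rank is `K` and its size is forced. -/
theorem card_eq_of_local [DecidableEq ι] {A : Submodule F (ι → F)} {K E l : ℕ} (hK : 1 ≤ K) (hE : 1 ≤ E)
    (hdim : finrank F A = (l + 1) * K)
    (hdet : ∀ a ∈ A, ∀ T : Finset ι, l * (K + E) + K ≤ T.card → (∀ i ∈ T, a i = 0) → a = 0)
    (hloc : ∀ i, ∃ S : Finset ι, i ∈ S ∧ S.card ≤ K + E ∧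
      ((E + 1 : ℕ) : ℕ∞) ≤ minDist (puncture A S))
    {S : Finset ι} (hne : S.Nonempty) (hcard : S.card ≤ K + E)
    (hS : ((E + 1 : ℕ) : ℕ∞) ≤ minDist (puncture A S)) :
    S.card = K + E ∧ finrank F (puncture A S) = K := by
  have h1 : ∀ U : Finset ι, finrank F (puncture A U) < K → U.card ≤ finrank F (puncture A U) :=
    fun U hU => by
      simpa using card_le_of_finrank_lt_mul hdim hdet hloc l 0 U (by omega) (by simpa using hU)
  have h0 := puncture_finrank_le_card A ∅
  rw [Finset.card_empty] at h0
  have hpos := Finset.card_pos.2 hne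
  have hr : 0 < finrank F (puncture A S) := by
    by_contra hcon
    have := h1 S (by omega)
    omega
  have h2 := finrank_union_add_le (U := ∅) hS (by rw [Finset.empty_union]; omega)
  rw [Finset.empty_union, Finset.sdiff_empty] at h2
  have h3 := finrank_le_of_local hcard hS
  have h4 : ¬ finrank F (puncture A S) < K := fun h => by
    have := h1 S h
    omega
  omega

/-- By the case `j = 1`, a set of rank below `2 K` has nullity at most `E`. If `S'` adds rank to
`S`, the union has nullity at least `2 E`, so its rank is `2 K` and `S'` brings `K + E` new
coordinates. If not, the union has only `K + E` elements and equals both sets. -/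
theorem disjoint_of_local [DecidableEq ι] {A : Submodule F (ι → F)} {K E l : ℕ} (hK : 1 ≤ K) (hE : 1 ≤ E)
    (hl : 1 ≤ l) (hdim : finrank F A = (l + 1) * K)
    (hdet : ∀ a ∈ A, ∀ T : Finset ι, l * (K + E) + K ≤ T.card → (∀ i ∈ T, a i = 0) → a = 0)
    (hloc : ∀ i, ∃ S : Finset ι, i ∈ S ∧ S.card ≤ K + E ∧
      ((E + 1 : ℕ) : ℕ∞) ≤ minDist (puncture A S))
    {S S' : Finset ι} (hcard : S.card ≤ K + E)
    (hS : ((E + 1 : ℕ) : ℕ∞) ≤ minDist (puncture A S)) (hcard' : S'.card ≤ K + E)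
    (hS' : ((E + 1 : ℕ) : ℕ∞) ≤ minDist (puncture A S')) (hne : S ≠ S') : Disjoint S S' := by
  rcases S.eq_empty_or_nonempty with rfl | hn
  · exact Finset.disjoint_empty_left _
  rcases S'.eq_empty_or_nonempty with rfl | hn'
  · exact Finset.disjoint_empty_right _
  obtain ⟨c1, r1⟩ := card_eq_of_local hK hE hdim hdet hloc hn hcard hS
  obtain ⟨c2, r2⟩ := card_eq_of_local hK hE hdim hdet hloc hn' hcard' hS'
  have h2 : finrank F (puncture A (S ∪ S')) < 2 * K →
      (S ∪ S').card ≤ finrank F (puncture A (S ∪ S')) + E := fun hU => by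
    simpa using card_le_of_finrank_lt_mul hdim hdet hloc (l - 1) 1 (S ∪ S') (by omega)
      (by simpa using hU)
  have hu := Finset.card_union_add_card_inter S S'
  by_cases hlt : finrank F (puncture A S) < finrank F (puncture A (S ∪ S'))
  · have h3 := finrank_union_add_le hS' hlt
    have h4 := Finset.card_sdiff_add_card S' S
    rw [Finset.union_comm S' S] at h4
    have h5 := finrank_union_le_add (U := S) hcard' hS'
    rw [Finset.disjoint_iff_inter_eq_empty, ← Finset.card_eq_zero]
    by_cases h6 : finrank F (puncture A (S ∪ S')) < 2 * K
    · have := h2 h6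
      omega
    · omega
  · have h3 := h2 (by omega)
    have h4 : S ∪ S' = S :=
      (Finset.eq_of_subset_of_card_le Finset.subset_union_left (by omega)).symm
    have h5 : S ∪ S' = S' :=
      (Finset.eq_of_subset_of_card_le Finset.subset_union_right (by omega)).symm
    exact absurd (h4.symm.trans h5) hne

/-- Singleton bound: fewer coordinates than the dimension leave a nonzero codeword vanishing on
them. -/
theorem minDist_add_le {B : Submodule F (ι → F)} (hB : 1 ≤ finrank F B) :
    minDist B ≤ (Fintype.card ι - finrank F B + 1 : ℕ) := by
  have hle : finrank F B ≤ Fintype.card ι := by simpa using Submodule.finrank_le B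
  obtain ⟨T, -, hT⟩ := Finset.exists_subset_card_eq (s := (Finset.univ : Finset ι))
    (n := finrank F B - 1) (by rw [Finset.card_univ]; omega)
  have h1 := puncture_finrank_le_card B T
  have h2 := puncture_finrank_eq_self (T := Finset.univ) B
    fun a _ h => funext fun i => h i (Finset.mem_univ i)
  obtain ⟨b, hb, h0, i, -, hi⟩ := exists_of_puncture_finrank_lt (T := T) (U := Finset.univ)
    (A := B) (by omega)
  exact minDist_le_of_exists hb (fun h => hi (congrFun h i)) T (by omega) h0

theorem finrank_eq_of_card_eq [DecidableEq ι] {A : Submodule F (ι → F)} {K E l : ℕ}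
    (hdim : finrank F A = (l + 1) * K)
    (hdet : ∀ a ∈ A, ∀ T : Finset ι, l * (K + E) + K ≤ T.card → (∀ i ∈ T, a i = 0) → a = 0)
    (hloc : ∀ i, ∃ S : Finset ι, i ∈ S ∧ S.card ≤ K + E ∧
      ((E + 1 : ℕ) : ℕ∞) ≤ minDist (puncture A S))
    {S : Finset ι} (hcard : S.card = K + E)
    (hS : ((E + 1 : ℕ) : ℕ∞) ≤ minDist (puncture A S)) : finrank F (puncture A S) = K := by
  refine le_antisymm (finrank_le_of_local hcard.le hS) (not_lt.1 fun h => ?_)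
  have h1 := card_le_of_finrank_lt_mul hdim hdet hloc l 0 S (by omega) (by simpa using h)
  omega

theorem isMDS_of_local [DecidableEq ι] {A : Submodule F (ι → F)} {K E l : ℕ} (hK : 1 ≤ K)
    (hdim : finrank F A = (l + 1) * K)
    (hdet : ∀ a ∈ A, ∀ T : Finset ι, l * (K + E) + K ≤ T.card → (∀ i ∈ T, a i = 0) → a = 0)
    (hloc : ∀ i, ∃ S : Finset ι, i ∈ S ∧ S.card ≤ K + E ∧
      ((E + 1 : ℕ) : ℕ∞) ≤ minDist (puncture A S))
    {S : Finset ι} (hcard : S.card = K + E)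
    (hS : ((E + 1 : ℕ) : ℕ∞) ≤ minDist (puncture A S)) :
    IsMDS (puncture A S) K ∧ minDist (puncture A S) = (E + 1 : ℕ) := by
  have hr := finrank_eq_of_card_eq hdim hdet hloc hcard hS
  have hd : minDist (puncture A S) = (E + 1 : ℕ) := by
    refine le_antisymm ?_ hS
    have h := minDist_add_le (B := puncture A S) (by omega)
    rwa [hr, Fintype.card_coe, hcard, Nat.add_sub_cancel_left] at h
  refine ⟨⟨hr, ?_⟩, hd⟩
  rw [hd, Fintype.card_coe, hcard]
  norm_cast
  omega

theorem card_eq_of_partition [DecidableEq ι] {m N : ℕ} (hι : Fintype.card ι = m * N) (S : Fin m → Finset ι)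
    (hcard : ∀ i, (S i).card ≤ N) (hdisj : ∀ i j, i ≠ j → Disjoint (S i) (S j))
    (hcover : Finset.univ.biUnion S = Finset.univ) (i : Fin m) : (S i).card = N := by
  have h1 : ∑ i, (S i).card = ∑ _i : Fin m, N := by
    rw [← Finset.card_biUnion fun i _ j _ h => hdisj i j h, hcover, Finset.card_univ, hι]
    simp
  exact (Finset.sum_eq_sum_iff_of_le fun i _ => hcard i).1 h1 i (Finset.mem_univ i)

theorem exists_partition [DecidableEq ι] {m N : ℕ} (hι : Fintype.card ι = m * N) :
    ∃ S : Fin m → Finset ι, (∀ i, (S i).card = N) ∧ (∀ i j, i ≠ j → Disjoint (S i) (S j)) ∧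
      Finset.univ.biUnion S = Finset.univ := by
  let e : Fin m × Fin N ≃ ι := finProdFinEquiv.trans (Fintype.equivFinOfCardEq hι).symm
  have hmem : ∀ i x, x ∈ (({i} : Finset (Fin m)) ×ˢ Finset.univ).map e.toEmbedding ↔
      (e.symm x).1 = i := by
    intro i x
    rw [Finset.mem_map_equiv, Finset.mem_product, Finset.mem_singleton]
    exact and_iff_left (Finset.mem_univ _)
  refine ⟨fun i => (({i} : Finset (Fin m)) ×ˢ Finset.univ).map e.toEmbedding,
    fun i => by simp, fun i j hij => Finset.disjoint_left.2 fun x hx hx' => hij ?_, ?_⟩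
  · rw [← (hmem i x).1 hx, (hmem j x).1 hx']
  · exact Finset.eq_univ_iff_forall.2 fun x => Finset.mem_biUnion.2
      ⟨_, Finset.mem_univ _, (hmem _ x).2 rfl⟩

theorem exists_local_partition [DecidableEq ι] {A : Submodule F (ι → F)} {K E l m : ℕ} (hK : 1 ≤ K)
    (hι : Fintype.card ι = m * (K + E)) (hdim : finrank F A = (l + 1) * K)
    (hdet : ∀ a ∈ A, ∀ T : Finset ι, l * (K + E) + K ≤ T.card → (∀ i ∈ T, a i = 0) → a = 0)
    (hloc : ∀ i, ∃ S : Finset ι, i ∈ S ∧ S.card ≤ K + E ∧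
      ((E + 1 : ℕ) : ℕ∞) ≤ minDist (puncture A S)) :
    ∃ S : Fin m → Finset ι, (∀ i, (S i).card = K + E) ∧
      (∀ i, ((E + 1 : ℕ) : ℕ∞) ≤ minDist (puncture A (S i))) ∧
      (∀ i j, i ≠ j → Disjoint (S i) (S j)) ∧ Finset.univ.biUnion S = Finset.univ := by
  by_cases hlE : 1 ≤ l ∧ 1 ≤ E
  · obtain ⟨hl, hE⟩ := hlE
    choose f hf hfcard hfd using hloc
    let P : Finset (Finset ι) := Finset.univ.image f
    have hP : ∀ S ∈ P, S.Nonempty ∧ S.card = K + E ∧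
        ((E + 1 : ℕ) : ℕ∞) ≤ minDist (puncture A S) := by
      intro S hS
      obtain ⟨i, -, rfl⟩ := Finset.mem_image.1 hS
      exact ⟨⟨i, hf i⟩, (card_eq_of_local hK hE hdim hdet
        (fun i => ⟨f i, hf i, hfcard i, hfd i⟩) ⟨i, hf i⟩ (hfcard i) (hfd i)).1, hfd i⟩
    have hdisj : ∀ S ∈ P, ∀ S' ∈ P, S ≠ S' → Disjoint S S' := fun S hS S' hS' hne =>
      disjoint_of_local hK hE hl hdim hdet (fun i => ⟨f i, hf i, hfcard i, hfd i⟩)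
        (hP S hS).2.1.le (hP S hS).2.2 (hP S' hS').2.1.le (hP S' hS').2.2 hne
    have hcover : P.biUnion id = Finset.univ := Finset.eq_univ_iff_forall.2 fun i =>
      Finset.mem_biUnion.2 ⟨f i, Finset.mem_image_of_mem f (Finset.mem_univ i), hf i⟩
    have hcard : P.card = m := by
      have h1 := Finset.card_biUnion (s := P) (t := id) fun S hS S' hS' h => hdisj S hS S' hS' h
      rw [hcover, Finset.card_univ, hι, Finset.sum_congr rfl fun S hS => show (id S).card = K + E from
        (hP S hS).2.1, Finset.sum_const, smul_eq_mul] at h1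
      exact (Nat.eq_of_mul_eq_mul_right (by omega) h1).symm
    let g : Fin m ≃ P := (P.equivFinOfCardEq hcard).symm
    refine ⟨fun i => g i, fun i => (hP _ (g i).2).2.1, fun i => (hP _ (g i).2).2.2,
      fun i j hij => hdisj _ (g i).2 _ (g j).2 fun h => hij (g.injective (Subtype.ext h)), ?_⟩
    refine Finset.eq_univ_iff_forall.2 fun x => ?_
    obtain ⟨S, hS, hx⟩ := Finset.mem_biUnion.1 (hcover ▸ Finset.mem_univ x)
    exact Finset.mem_biUnion.2 ⟨g.symm ⟨S, hS⟩, Finset.mem_univ _, by simpa using hx⟩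
  -- The given local codes may overlap here, but any blocks of size `K + E` do: for `E = 0` only
  -- distance one is asked, and for `l = 0` any `K` coordinates determine the codeword.
  · obtain ⟨S, hcard, hdisj, hcover⟩ := exists_partition (ι := ι) hι
    refine ⟨S, hcard, fun i => ?_, hdisj, hcover⟩
    rw [le_minDist_puncture_iff, hcard i]
    intro a ha T hT hTc h0
    by_cases hE : E = 0
    · have : T = S i := Finset.eq_of_subset_of_card_le hT (by rw [hcard i]; omega)
      rwa [← this]
    · have hl : l = 0 := by omega
      rw [hdet a ha T (by rw [hl]; omega) h0]
      exact fun _ _ => rfl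

end Structure

/-! ### Binomial identities and convexity -/

section Counting

theorem succ_choose_two (x : ℕ) : (x + 1).choose 2 = x + x.choose 2 := by
  rw [Nat.choose_succ_succ' x 1, Nat.choose_one_right]

theorem sum_range_sub_add_choose (α s : ℕ) (hs : s ≤ α + 1) :
    ∑ j ∈ Finset.range s, (α - j) + (α + 1 - s).choose 2 = (α + 1).choose 2 := by
  induction s with
  | zero => simp
  | succ s ih =>
    rw [Finset.sum_range_succ, ← ih (by omega), show α + 1 - s = (α - s) + 1 by omega,
      succ_choose_two, show α + 1 - (s + 1) = α - s by omega]
    omega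

theorem localDim_eq_sum {α r : ℕ} (hr : r ≤ α + 1) :
    localDim α r = ∑ j ∈ Finset.range r, (α - j) := by
  have h : ∑ j ∈ Finset.range r, (α - j) + r.choose 2 = r * α := by
    induction r with
    | zero => simp
    | succ r ih =>
      rw [Finset.sum_range_succ, succ_choose_two, add_mul, one_mul,
        ← ih (by omega)]
      omega
  unfold localDim
  omega

theorem localDim_add_choose {α r : ℕ} (hr : r ≤ α + 1) :
    localDim α r + (α + 1 - r).choose 2 = localScalarLength α := by
  rw [localDim_eq_sum hr]
  exact sum_range_sub_add_choose α r hr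

theorem sum_mbrProfile (α r s : ℕ) :
    ∑ j ∈ Finset.range s, mbrProfile α r j = ∑ j ∈ Finset.range (min s r), (α - j) := by
  unfold mbrProfile
  rw [← Finset.sum_filter]
  congr 1
  ext j
  simp

theorem sum_range_sub_mono (α : ℕ) {s t : ℕ} (h : s ≤ t) :
    ∑ j ∈ Finset.range s, (α - j) ≤ ∑ j ∈ Finset.range t, (α - j) :=
  Finset.sum_le_sum_of_subset (Finset.range_mono h)

theorem sum_mbrProfile_eq_min {α r : ℕ} (hr : r ≤ α + 1) (s : ℕ) :
    ∑ j ∈ Finset.range s, mbrProfile α r j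
      = min (∑ j ∈ Finset.range s, (α - j)) (localDim α r) := by
  rw [sum_mbrProfile, localDim_eq_sum hr]
  rcases le_total s r with h | h
  · rw [min_eq_left h, min_eq_left (sum_range_sub_mono α h)]
  · rw [min_eq_right h, min_eq_right (sum_range_sub_mono α h)]

theorem one_le_localDim {α r : ℕ} (hr : 1 ≤ r) (hrα : r ≤ α) : α ≤ localDim α r := by
  rw [localDim_eq_sum (by omega)]
  simpa using sum_range_sub_mono α hr

theorem sum_lt_localDim {α r s : ℕ} (hs : s < r) (hrα : r ≤ α) :
    ∑ j ∈ Finset.range s, (α - j) < localDim α r := by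
  rw [localDim_eq_sum (by omega)]
  have h := sum_range_sub_mono α (Nat.succ_le_of_lt hs)
  rw [Nat.succ_eq_add_one, Finset.sum_range_succ] at h
  omega

theorem add_choose_two_eq (x y : ℕ) :
    (x + y).choose 2 = x.choose 2 + y.choose 2 + x * y := by
  induction y with
  | zero => simp
  | succ y ih =>
    rw [← add_assoc, succ_choose_two, succ_choose_two, ih, mul_add, mul_one]
    omega

theorem choose_two_add_le (x y : ℕ) : x.choose 2 + y.choose 2 ≤ (x + y).choose 2 := by
  have := add_choose_two_eq x y
  omega

/-- Convexity: with the sum fixed, moving the pair to the extremes `n` and `b` increases the total.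
Writing `n = x + z` and `x = b + w`, the gain is `w * z`. -/
theorem choose_two_add_le_of_le {n x y b : ℕ} (hx : x ≤ n) (hy : y ≤ n) (h : x + y = n + b) :
    x.choose 2 + y.choose 2 ≤ n.choose 2 + b.choose 2 := by
  obtain ⟨z, rfl⟩ := Nat.exists_eq_add_of_le hx
  obtain rfl : y = z + b := by omega
  obtain ⟨w, rfl⟩ : ∃ w, x = b + w := Nat.exists_eq_add_of_le (by omega)
  have h1 := add_choose_two_eq (b + w) z
  have h2 := add_choose_two_eq z b
  have h3 : (b + w) * z = z * b + w * z := by ring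
  omega

/-- The extremal configuration fills `a` parts to capacity and puts the remainder `b` in one more.
Each new part is charged to that remainder if it fits, and otherwise uses up one full part. -/
theorem sum_choose_two_le {κ : Type*} [DecidableEq κ] {n : ℕ} (u : κ → ℕ) (hu : ∀ i, u i ≤ n)
    (I : Finset κ) : ∀ a b : ℕ, b < n → ∑ i ∈ I, u i ≤ a * n + b →
      ∑ i ∈ I, (u i).choose 2 ≤ a * n.choose 2 + b.choose 2 := by
  induction I using Finset.induction_on with
  | empty => simp
  | insert x I hx ih =>
    intro a b hb hsum
    rw [Finset.sum_insert hx] at hsum ⊢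
    have hux := hu x
    by_cases hxb : u x ≤ b
    · have h1 := ih a (b - u x) (by omega) (by omega)
      have h2 := choose_two_add_le (u x) (b - u x)
      rw [Nat.add_sub_cancel' hxb] at h2
      omega
    · obtain ⟨a, rfl⟩ : ∃ a', a = a' + 1 := by
        refine ⟨a - 1, ?_⟩
        rcases a.eq_zero_or_pos with rfl | h
        · omega
        · omega
      rw [add_mul, one_mul] at hsum ⊢
      have h1 := ih a (n + b - u x) (by omega) (by omega)
      have h2 := choose_two_add_le_of_le (x := u x) (y := n + b - u x) (b := b) hux
        (by omega) (by omega)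
      omega

end Counting

/-! ### Edges of the complete graph -/

section Edges

variable {α : ℕ}

/-- The edges with both ends in `Y`. -/
def innerEdges (Y : Finset (Fin (α + 1))) : Finset (Edge α) :=
  Finset.univ.filter fun x => ∀ v ∈ (x : Sym2 (Fin (α + 1))), v ∈ Y

/-- The edges with at least one end in `X`. -/
def incidentEdges (X : Finset (Fin (α + 1))) : Finset (Edge α) :=
  Finset.univ.filter fun x => ∃ v ∈ X, v ∈ (x : Sym2 (Fin (α + 1)))

theorem card_innerEdges (Y : Finset (Fin (α + 1))) : (innerEdges Y).card = Y.card.choose 2 := by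
  rw [← Sym2.card_image_offDiag, ← Finset.card_map (Function.Embedding.subtype _)]
  congr 1
  ext x
  induction x with
  | _ v w =>
    simp only [innerEdges, Finset.mem_map, Finset.mem_filter, Finset.mem_univ, true_and,
      Function.Embedding.subtype_apply, Finset.mem_image, Finset.mem_offDiag, Prod.exists]
    constructor
    · rintro ⟨x, hx, hxe⟩
      have h1 := x.2
      rw [hxe] at hx h1
      exact ⟨v, w, ⟨hx v (Sym2.mem_mk_left v w), hx w (Sym2.mem_mk_right v w), h1⟩, rfl⟩
    · rintro ⟨a, b, ⟨ha, hb, hab⟩, hvw⟩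
      refine ⟨⟨s(a, b), hab⟩, fun u hu => ?_, hvw⟩
      rcases Sym2.mem_iff.1 hu with rfl | rfl
      · exact ha
      · exact hb

theorem card_edge (α : ℕ) : Fintype.card (Edge α) = localScalarLength α := by
  have h := card_innerEdges (Finset.univ : Finset (Fin (α + 1)))
  rw [Finset.card_univ, Fintype.card_fin] at h
  rw [localScalarLength, ← h, innerEdges, Finset.filter_true_of_mem fun _ _ _ _ => Finset.mem_univ _,
    Finset.card_univ]

theorem card_incidentEdges (X : Finset (Fin (α + 1))) :
    (incidentEdges X).card = ∑ j ∈ Finset.range X.card, (α - j) := by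
  -- The edges missing `X` are those inside its complement, which are easy to count.
  have h1 : (incidentEdges X)ᶜ = innerEdges Xᶜ := by
    ext x
    simp only [incidentEdges, innerEdges, Finset.mem_compl, Finset.mem_filter, Finset.mem_univ,
      true_and, not_exists, not_and]
    exact ⟨fun h v hv hX => h v hX hv, fun h v hX hv => h v hv hX⟩
  have h2 := Finset.card_compl_add_card (incidentEdges X)
  rw [h1, card_innerEdges, Finset.card_compl, Fintype.card_fin, card_edge, localScalarLength] at h2
  have h3 : X.card ≤ α + 1 := by simpa using X.card_le_univ
  have h4 := sum_range_sub_add_choose α X.card h3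
  omega

theorem mem_incidentEdges {X : Finset (Fin (α + 1))} {x : Edge α} :
    x ∈ incidentEdges X ↔ ∃ v ∈ X, ∃ j, edge v j = x := by
  simp only [incidentEdges, Finset.mem_filter, Finset.mem_univ, true_and]
  refine exists_congr fun v => and_congr_right fun _ => ⟨fun h => ?_, ?_⟩
  · obtain ⟨w, hw⟩ := Sym2.mem_iff_exists.1 h
    have h1 := x.2
    rw [hw, SimpleGraph.mem_edgeSet, SimpleGraph.top_adj] at h1
    obtain ⟨j, rfl⟩ := Fin.exists_succAbove_eq h1.symm
    exact ⟨j, Subtype.ext hw.symm⟩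
  · rintro ⟨j, rfl⟩
    exact Sym2.mem_mk_left _ _

theorem forall_incidentEdges {X : Finset (Fin (α + 1))} {p : Edge α → Prop} :
    (∀ x ∈ incidentEdges X, p x) ↔ ∀ v ∈ X, ∀ j, p (edge v j) := by
  simp only [mem_incidentEdges]
  exact ⟨fun h v hv j => h _ ⟨v, hv, j, rfl⟩, by rintro h _ ⟨v, hv, j, rfl⟩; exact h v hv j⟩

theorem edge_symm {v w : Fin (α + 1)} {i j : Fin α} (h : v.succAbove i = w)
    (h' : w.succAbove j = v) : edge v i = edge w j := by
  refine Subtype.ext ?_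
  change s(v, v.succAbove i) = s(w, w.succAbove j)
  rw [h, h', Sym2.eq_swap]

theorem incidentEdges_univ : incidentEdges (Finset.univ : Finset (Fin (α + 1))) = Finset.univ :=
  Finset.filter_true_of_mem fun x _ =>
    ⟨(Quot.out (x : Sym2 (Fin (α + 1)))).1, Finset.mem_univ _, Sym2.out_fst_mem _⟩

end Edges

/-! ### Ranks in MDS codes -/

section MDS

variable {F ι : Type*} [Field F] [Fintype ι]

theorem IsMDS.eq_zero {B : Submodule F (ι → F)} {K : ℕ} (hB : IsMDS B K) {b : ι → F} (hb : b ∈ B)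
    {T : Finset ι} (hT : K ≤ T.card) (h0 : ∀ i ∈ T, b i = 0) : b = 0 := by
  obtain ⟨hdim, hd⟩ := hB
  have hK : K ≤ Fintype.card ι := by
    rw [← hdim]
    simpa using Submodule.finrank_le B
  refine (le_minDist_iff B (Fintype.card ι + 1 - K)).1 ?_ b hb T (by omega) h0
  rw [← ENat.add_le_add_iff_right (ENat.natCast_ne_top K), hd]
  norm_cast
  omega

theorem IsMDS.finrank_puncture {B : Submodule F (ι → F)} {K : ℕ} (hB : IsMDS B K)
    (T : Finset ι) : finrank F (puncture B T) = min T.card K := by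
  classical
  have hK : K ≤ Fintype.card ι := by
    rw [← hB.1]
    simpa using Submodule.finrank_le B
  have full : ∀ U : Finset ι, K ≤ U.card → finrank F (puncture B U) = K := fun U hU => by
    rw [puncture_finrank_eq_self B fun b hb h => hB.eq_zero hb hU h, hB.1]
  rcases le_total K T.card with h | h
  · rw [full T h, min_eq_right h]
  · obtain ⟨U, hTU, hU⟩ := Finset.exists_superset_card_eq h hK
    have h1 := puncture_finrank_union_le B T (U \ T)
    rw [Finset.union_sdiff_of_subset hTU, full U hU.ge] at h1
    have h2 := Finset.card_sdiff_add_card_eq_card hTU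
    have h3 := puncture_finrank_le_card B T
    omega

end MDS

/-! ### The repair-by-transfer code on one group -/

section LocalCode

variable {F κ : Type*} [Field F] {α r : ℕ}

theorem rbt_zero_iff (b : Edge α → F) (X : Finset (Fin (α + 1))) :
    (∀ v ∈ X, rbtMap F α b v = 0) ↔ ∀ x ∈ incidentEdges X, b x = 0 := by
  rw [forall_incidentEdges]
  exact forall₂_congr fun v _ => ⟨fun h j => congrFun h j, fun h => funext fun j => h j⟩

/-- The repair-by-transfer code on the nodes `κ`, named by `σ`, built on `B`. -/
abbrev rbtCode (B : Submodule F (Edge α → F)) (σ : κ ≃ Fin (α + 1)) :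
    Submodule F (κ → Fin α → F) :=
  (B.map (rbtMap F α)).map (LinearMap.funLeft F (Fin α → F) σ)

theorem mem_rbtCode {B : Submodule F (Edge α → F)} {σ : κ ≃ Fin (α + 1)} {c : κ → Fin α → F} :
    c ∈ rbtCode B σ ↔ ∃ b ∈ B, (fun k => rbtMap F α b (σ k)) = c := by
  constructor
  · rintro ⟨_, ⟨b, hb, rfl⟩, rfl⟩
    exact ⟨b, hb, rfl⟩
  · rintro ⟨b, hb, rfl⟩
    exact ⟨_, ⟨b, hb, rfl⟩, rfl⟩

theorem rbt_zero_iff_of_equiv (b : Edge α → F) (σ : κ ≃ Fin (α + 1)) (T : Finset κ) :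
    (∀ k ∈ T, rbtMap F α b (σ k) = 0) ↔
      ∀ x ∈ incidentEdges (T.map σ.toEmbedding), b x = 0 := by
  rw [← rbt_zero_iff]
  simp only [Finset.mem_map_equiv]
  exact ⟨fun h v hv => by simpa using h _ hv, fun h k hk => h (σ k) (by simpa using hk)⟩

theorem finrank_puncture_rbtCode [Fintype κ] {B : Submodule F (Edge α → F)}
    (hB : IsMDS B (localDim α r)) (σ : κ ≃ Fin (α + 1)) (T : Finset κ) :
    finrank F (puncture (rbtCode B σ) T)
      = min (∑ j ∈ Finset.range T.card, (α - j)) (localDim α r) := by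
  unfold puncture
  rw [← Submodule.map_comp, ← Submodule.map_comp,
    finrank_map_eq_of_ker B _ (LinearMap.funLeft F F
      (fun x : incidentEdges (T.map σ.toEmbedding) => (x : Edge α)))]
  · rw [← puncture, hB.finrank_puncture, card_incidentEdges, Finset.card_map]
  · intro b _
    rw [restrict_eq_zero_iff, ← rbt_zero_iff_of_equiv]
    exact restrict_eq_zero_iff (F := F) T (fun k => rbtMap F α b (σ k))

theorem isURA_rbtCode [Fintype κ] {B : Submodule F (Edge α → F)} (hB : IsMDS B (localDim α r))
    (hr : r ≤ α + 1) (σ : κ ≃ Fin (α + 1)) : IsURA (rbtCode B σ) (mbrProfile α r) := fun T => by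
  rw [finrank_puncture_rbtCode hB σ T, sum_mbrProfile_eq_min hr]

theorem rbtMap_eq_zero_of_forall [Fintype κ] {B : Submodule F (Edge α → F)}
    (hB : IsMDS B (localDim α r)) (hr : r ≤ α + 1) (σ : κ ≃ Fin (α + 1)) {b : Edge α → F}
    (hb : b ∈ B) {T : Finset κ} (hT : r ≤ T.card) (h0 : ∀ k ∈ T, rbtMap F α b (σ k) = 0) :
    b = 0 := by
  refine hB.eq_zero hb ?_ ((rbt_zero_iff_of_equiv b σ T).1 h0)
  rw [card_incidentEdges, Finset.card_map, localDim_eq_sum hr]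
  exact sum_range_sub_mono α hT

/-- Any `r` nodes see at least `K_L` edges and hence determine the codeword, while `r - 1` nodes see
fewer. So the distance is `(α + 1) - (r - 1) = δ`. -/
theorem minDist_rbtCode [Fintype κ] {B : Submodule F (Edge α → F)}
    (hB : IsMDS B (localDim α r)) (hr : 1 ≤ r) (hrα : r ≤ α) (σ : κ ≃ Fin (α + 1)) {δ : ℕ}
    (hδ : r + δ = α + 2) : minDist (rbtCode B σ) = δ := by
  have hκ : Fintype.card κ = α + 1 := by rw [Fintype.card_congr σ, Fintype.card_fin]
  refine le_antisymm ?_ ((le_minDist_iff _ _).2 fun c hc T hT h0 => ?_)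
  · obtain ⟨T, -, hT⟩ := Finset.exists_subset_card_eq (s := (Finset.univ : Finset κ))
      (n := r - 1) (by rw [Finset.card_univ]; omega)
    have h1 := hB.finrank_puncture (incidentEdges (T.map σ.toEmbedding))
    rw [card_incidentEdges, Finset.card_map, hT] at h1
    have h2 := puncture_finrank_eq_self (T := Finset.univ) B
      fun a _ h => funext fun i => h i (Finset.mem_univ i)
    have h3 := sum_lt_localDim (s := r - 1) (by omega) hrα
    rw [hB.1] at h2
    obtain ⟨b, hb, h0, i, -, hi⟩ := exists_of_puncture_finrank_lt
      (T := incidentEdges (T.map σ.toEmbedding)) (U := Finset.univ) (A := B) (by omega)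
    refine minDist_le_of_exists (mem_rbtCode.2 ⟨b, hb, rfl⟩) (fun h => hi ?_) T (by omega)
      ((rbt_zero_iff_of_equiv b σ T).2 h0)
    refine (rbt_zero_iff b Finset.univ).1 (fun v _ => ?_) i (by simp [incidentEdges_univ])
    simpa using congrFun h (σ.symm v)
  · obtain ⟨b, hb, rfl⟩ := mem_rbtCode.1 hc
    rw [rbtMap_eq_zero_of_forall hB (by omega) σ hb (by omega) h0]
    rfl

theorem isVectorCode_rbtCode [Fintype κ] {B : Submodule F (Edge α → F)}
    (hB : IsMDS B (localDim α r)) (hr : 1 ≤ r) (hrα : r ≤ α) (σ : κ ≃ Fin (α + 1)) :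
    IsVectorCode (rbtCode B σ) := by
  intro k v
  have h1 : finrank F ((rbtCode B σ).map (LinearMap.proj k)) = α := by
    rw [finrank_map_eq_of_ker _ _ (LinearMap.funLeft F (Fin α → F)
      (fun x : ({k} : Finset κ) => (x : κ)))]
    · have h := finrank_puncture_rbtCode hB σ {k}
      rw [Finset.card_singleton, Finset.sum_range_one, Nat.sub_zero,
        min_eq_left (one_le_localDim hr hrα)] at h
      exact h
    · intro c _
      rw [restrict_eq_zero_iff]
      simp
  have h2 : (rbtCode B σ).map (LinearMap.proj k) = ⊤ :=
    Submodule.eq_top_of_finrank_eq (by rw [h1]; simp)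
  have h3 : v ∈ (rbtCode B σ).map (LinearMap.proj k) := h2 ▸ Submodule.mem_top
  obtain ⟨c, hc, hcv⟩ := h3
  exact ⟨c, hc, hcv⟩

/-- As `d = α`, the helpers are all the other nodes, and each transfers the one symbol on the edge
it shares with `f`. -/
theorem repair_rbtCode [Fintype κ] (B : Submodule F (Edge α → F)) (σ : κ ≃ Fin (α + 1)) (f : κ)
    (D : Finset κ) (hf : f ∉ D) (hD : D.card = α) :
    ∃ (g : D → (Fin α → F) →ₗ[F] (Fin 1 → F)) (R : (D → Fin 1 → F) →ₗ[F] (Fin α → F)),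
      ∀ c ∈ rbtCode B σ, c f = R (fun h => g h (c h)) := by
  classical
  have hκ : Fintype.card κ = α + 1 := by rw [Fintype.card_congr σ, Fintype.card_fin]
  have hmem : ∀ k, k ≠ f → k ∈ D := by
    intro k hk
    have h1 : insert f D = Finset.univ := Finset.eq_univ_of_card _ (by
      rw [Finset.card_insert_of_notMem hf, hD, hκ])
    exact (Finset.mem_insert.1 (h1 ▸ Finset.mem_univ k)).resolve_left hk
  have hne : ∀ h : D, ∃ j, (σ h).succAbove j = σ f := fun h =>
    Fin.exists_succAbove_eq fun heq => hf (σ.injective heq ▸ h.2)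
  choose t ht using hne
  have hnb : ∀ j, σ.symm ((σ f).succAbove j) ∈ D := fun j => hmem _ fun h =>
    Fin.succAbove_ne (σ f) j (σ.symm_apply_eq.1 h)
  refine ⟨fun h => LinearMap.pi fun _ => LinearMap.proj (t h),
    LinearMap.pi fun j => LinearMap.proj (0 : Fin 1) ∘ₗ LinearMap.proj ⟨_, hnb j⟩, ?_⟩
  intro c hc
  obtain ⟨b, -, rfl⟩ := mem_rbtCode.1 hc
  funext j
  refine congrArg b (edge_symm ?_ (ht ⟨_, hnb j⟩))
  rw [Equiv.apply_symm_apply]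

theorem cutSet_mbr {α r : ℕ} (hrα : r ≤ α) : cutSet r α α 1 = localDim α r := by
  rw [localDim_eq_sum (by omega), cutSet]
  refine Finset.sum_congr rfl fun j _ => ?_
  rw [mul_one, min_eq_right (Nat.sub_le α j)]

theorem isMBR_rbtCode [Fintype κ] {B : Submodule F (Edge α → F)}
    (hB : IsMDS B (localDim α r)) (hr : 1 ≤ r) (hrα : r ≤ α) (σ : κ ≃ Fin (α + 1)) :
    IsMBR (rbtCode B σ) (α + 1) r α 1 (localDim α r) := by
  have hκ : Fintype.card κ = α + 1 := by rw [Fintype.card_congr σ, Fintype.card_fin]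
  have hK := one_le_localDim hr hrα
  refine ⟨⟨hκ, hr, hrα, by omega, by omega, ?_, isVectorCode_rbtCode hB hr hrα σ, ?_,
    repair_rbtCode B σ⟩, (cutSet_mbr hrα).symm, ?_, ?_, by omega⟩
  · rw [rbtCode, ← Submodule.map_comp, finrank_map_eq_self, hB.1]
    intro b hb h
    exact rbtMap_eq_zero_of_forall hB (by omega) σ hb (T := Finset.univ)
      (by rw [Finset.card_univ]; omega) fun k _ => congrFun h k
  · intro T hT c hc c' hc' h
    obtain ⟨b, hb, hbc⟩ := mem_rbtCode.1 (Submodule.sub_mem _ hc hc')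
    have h1 := rbtMap_eq_zero_of_forall hB (by omega) σ hb hT.ge fun k hk => by
      have h2 := congrFun hbc k
      rw [Pi.sub_apply, h k hk, sub_self] at h2
      exact h2
    rw [h1] at hbc
    exact sub_eq_zero.1 hbc.symm
  · intro α' hα'
    rw [← cutSet_mbr hrα]
    -- The term `j = 0` equals `α`, since `d β = α`, and it alone drops strictly.
    refine Finset.sum_lt_sum (fun j _ => min_le_min_right _ hα'.le)
      ⟨0, Finset.mem_range.2 hr, ?_⟩
    rw [mul_one, Nat.sub_zero, min_self]
    exact (min_le_left _ _).trans_lt hα'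
  · intro β' hβ'
    obtain rfl : β' = 0 := by omega
    simp only [cutSet, mul_zero, Nat.min_zero, Finset.sum_const_zero]
    omega

end LocalCode

/-! ### The periodic rank profile -/

section LeadingSum

variable {α r : ℕ}

theorem leadingSum_mbrProfile (hr : r ≤ α + 1) (q b : ℕ) (hb : b ≤ α + 1) :
    leadingSum (mbrProfile α r) (α + 1) (q * (α + 1) + b)
      = q * localDim α r + ∑ j ∈ Finset.range b, mbrProfile α r j := by
  unfold leadingSum
  have small : ∀ b ≤ α + 1, ∑ j ∈ Finset.range b, mbrProfile α r (j % (α + 1))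
      = ∑ j ∈ Finset.range b, mbrProfile α r j := fun b hb =>
    Finset.sum_congr rfl fun j hj => by
      rw [Nat.mod_eq_of_lt ((Finset.mem_range.1 hj).trans_le hb)]
  induction q with
  | zero => rw [zero_mul, zero_add, zero_mul, zero_add, small b hb]
  | succ q ih =>
    rw [show (q + 1) * (α + 1) + b = (α + 1) + (q * (α + 1) + b) by ring, Finset.sum_range_add,
      small _ le_rfl, sum_mbrProfile, min_eq_right hr, ← localDim_eq_sum hr]
    simp only [Nat.add_mod_left]
    rw [ih]
    ring

/-- Each period contributes `K_L`, all of it in its first `r` places with positive entries. So the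
sum `(l + 1) K_L` is first reached at place `r` of period `l + 1`. -/
theorem leadingSumInv_mbrProfile (hr : 1 ≤ r) (hrα : r ≤ α) (l : ℕ) :
    leadingSumInv (mbrProfile α r) (α + 1) ((l + 1) * localDim α r) = l * (α + 1) + r := by
  have hmem : (l + 1) * localDim α r
      ≤ leadingSum (mbrProfile α r) (α + 1) (l * (α + 1) + r) := by
    rw [leadingSum_mbrProfile (by omega) l r (by omega), sum_mbrProfile, min_self,
      ← localDim_eq_sum (by omega), add_mul, one_mul]
  refine le_antisymm (Nat.sInf_le hmem) (le_csInf ⟨_, hmem⟩ fun s hs => ?_)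
  by_contra hlt
  have h1 : leadingSum (mbrProfile α r) (α + 1) s
      ≤ leadingSum (mbrProfile α r) (α + 1) (l * (α + 1) + (r - 1)) :=
    Finset.sum_le_sum_of_subset (Finset.range_mono (by omega))
  rw [leadingSum_mbrProfile (by omega) l (r - 1) (by omega), sum_mbrProfile,
    min_eq_left (by omega)] at h1
  have h2 := sum_lt_localDim (s := r - 1) (by omega) hrα
  have h3 : (l + 1) * localDim α r ≤ leadingSum (mbrProfile α r) (α + 1) s := hs
  rw [add_mul, one_mul] at h3
  omega

end LeadingSum

/-! ### The global code and its distance -/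

section Construction

variable {F ι : Type*} [Field F] {α r m : ℕ}

/-- The `i`-th local code of `A`, with coordinates named by edges. -/
abbrev edgeCode {S : Finset ι} (A : Submodule F (ι → F)) (e : Edge α ≃ S) :
    Submodule F (Edge α → F) :=
  (puncture A S).map (LinearMap.funLeft F F e)

theorem isMDS_edgeCode {S : Finset ι} {A : Submodule F (ι → F)} {K : ℕ} (e : Edge α ≃ S)
    (h : IsMDS (puncture A S) K) : IsMDS (edgeCode A e) K := by
  refine ⟨?_, ?_⟩
  · rw [finrank_map_eq_self, h.1]
    intro a _ h0
    funext x
    simpa using congrFun h0 (e.symm x)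
  · rw [minDist_map_funLeft, h.2, Fintype.card_congr e]

theorem mem_rbtConstruction {A : Submodule F (ι → F)} {S : Fin m → Finset ι}
    {e : ∀ i, Edge α ≃ S i} {c : Fin m × Fin (α + 1) → Fin α → F} :
    c ∈ rbtConstruction A S e ↔
      ∃ a ∈ A, (fun p => rbtMap F α (fun x => a (e p.1 x)) p.2) = c := Iff.rfl

/-- The nodes of the `i`-th group, named by the vertices of the complete graph. -/
def nodeGroupEquiv (α m : ℕ) (i : Fin m) : nodeGroup α m i ≃ Fin (α + 1) where
  toFun p := p.1.2
  invFun v := ⟨(i, v), by simp [nodeGroup]⟩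
  left_inv := by
    rintro ⟨⟨j, v⟩, h⟩
    obtain rfl : i = j := by simpa [nodeGroup] using h
    rfl
  right_inv _ := rfl

theorem puncture_rbtConstruction (A : Submodule F (ι → F)) (S : Fin m → Finset ι)
    (e : ∀ i, Edge α ≃ S i) (i : Fin m) :
    puncture (rbtConstruction A S e) (nodeGroup α m i)
      = rbtCode (edgeCode A (e i)) (nodeGroupEquiv α m i) := by
  unfold rbtCode edgeCode puncture rbtConstruction
  rw [← Submodule.map_comp, ← Submodule.map_comp, ← Submodule.map_comp, ← Submodule.map_comp]
  congr 1
  refine LinearMap.ext fun a => funext ?_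
  rintro ⟨⟨j, v⟩, h⟩
  obtain rfl : i = j := by simpa [nodeGroup] using h
  rfl

theorem card_nodeGroup (α m : ℕ) (i : Fin m) : (nodeGroup α m i).card = α + 1 := by
  simp [nodeGroup]

theorem biUnion_nodeGroup (α m : ℕ) :
    Finset.univ.biUnion (nodeGroup α m) = Finset.univ :=
  Finset.eq_univ_iff_forall.2 fun p => Finset.mem_biUnion.2
    ⟨p.1, Finset.mem_univ _, by simp [nodeGroup]⟩

theorem disjoint_nodeGroup (α m : ℕ) {i j : Fin m} (h : i ≠ j) :
    Disjoint (nodeGroup α m i) (nodeGroup α m j) :=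
  Finset.disjoint_left.2 fun p hp hp' => h (by
    simp only [nodeGroup, Finset.mem_product, Finset.mem_singleton] at hp hp'
    rw [← hp.1, hp'.1])

theorem isVectorCode_of_puncture {κ : Type*}
    {C : Submodule F (ι → Fin α → F)} (S : κ → Finset ι)
    (hcover : ∀ i, ∃ k, i ∈ S k) (h : ∀ k, IsVectorCode (puncture C (S k))) : IsVectorCode C := by
  intro i v
  obtain ⟨k, hk⟩ := hcover i
  obtain ⟨_, ⟨c, hc, rfl⟩, hcv⟩ := h k ⟨i, hk⟩ v
  exact ⟨c, hc, hcv⟩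

variable [DecidableEq ι]

theorem eq_zero_of_edges [Fintype ι] {S : Fin m → Finset ι} (e : ∀ i, Edge α ≃ S i)
    (hcover : Finset.univ.biUnion S = Finset.univ) {a : ι → F} (h : ∀ i x, a (e i x) = 0) :
    a = 0 := by
  funext y
  obtain ⟨i, -, hy⟩ := Finset.mem_biUnion.1 (hcover ▸ Finset.mem_univ y)
  simpa using h i ((e i).symm ⟨y, hy⟩)

theorem eq_zero_of_rbt [Fintype ι] {S : Fin m → Finset ι} (e : ∀ i, Edge α ≃ S i)
    (hcover : Finset.univ.biUnion S = Finset.univ) {a : ι → F}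
    (h : (fun p : Fin m × Fin (α + 1) => rbtMap F α (fun x => a (e p.1 x)) p.2) = 0) :
    a = 0 := by
  refine eq_zero_of_edges e hcover fun i x => ?_
  exact (rbt_zero_iff (fun x => a (e i x)) Finset.univ).1
    (fun v _ => congrFun h (i, v)) x (by simp [incidentEdges_univ])

theorem finrank_rbtConstruction [Fintype ι] (A : Submodule F (ι → F)) {S : Fin m → Finset ι}
    (e : ∀ i, Edge α ≃ S i) (hcover : Finset.univ.biUnion S = Finset.univ) :
    finrank F (rbtConstruction A S e) = finrank F A :=
  finrank_map_eq_self A _ fun _ _ h => eq_zero_of_rbt e hcover h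

/-- The embedding of the edges of the `i`-th complete graph into the coordinates. -/
def edgeEmbedding {S : Finset ι} (e : Edge α ≃ S) : Edge α ↪ ι :=
  e.toEmbedding.trans (Function.Embedding.subtype _)

theorem card_eq_sum_fibers (T : Finset (Fin m × Fin (α + 1))) :
    T.card = ∑ i, (Finset.univ.filter fun v => (i, v) ∈ T).card := by
  simp only [Finset.card_filter]
  rw [← Fintype.sum_prod_type (f := fun p => if p ∈ T then 1 else 0), ← Finset.card_filter]
  simp

/-- A codeword of smaller weight has at most `(m - ℓ) n_L + δ - 1` nonzero nodes. By convexity at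
most `(m - ℓ) N_L + (δ - 1).choose 2` scalars escape the zero nodes, and `N_L - (δ - 1).choose 2 =
K_L`, so the known zeros number at least `l N_L + K_L`. -/
theorem le_minDist_rbtConstruction {A : Submodule F (ι → F)} {S : Fin m → Finset ι} {l δ : ℕ}
    (e : ∀ i, Edge α ≃ S i) (hdisj : ∀ i j, i ≠ j → Disjoint (S i) (S j))
    (hr : 1 ≤ r) (hrδ : r + δ = α + 2)
    (hδ : 1 ≤ δ) (hlm : l + 1 ≤ m)
    (hdet : ∀ a ∈ A, ∀ T : Finset ι, l * localScalarLength α + localDim α r ≤ T.card →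
      (∀ i ∈ T, a i = 0) → a = 0) :
    (((m - (l + 1)) * (α + 1) + δ : ℕ) : ℕ∞) ≤ minDist (rbtConstruction A S e) := by
  rw [le_minDist_iff]
  intro c hc T hT h0
  obtain ⟨a, ha, rfl⟩ := mem_rbtConstruction.1 hc
  let X : Fin m → Finset (Fin (α + 1)) := fun i => Finset.univ.filter fun v => (i, v) ∈ T
  -- The scalar coordinates stored at some node of `T`.
  let Z : Finset ι := Finset.univ.biUnion fun i => (incidentEdges (X i)).map (edgeEmbedding (e i))
  have hXle : ∀ i, (X i).card ≤ α + 1 := fun i => by simpa using (X i).card_le_univ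
  have hZ0 : ∀ y ∈ Z, a y = 0 := by
    intro y hy
    obtain ⟨i, -, hy⟩ := Finset.mem_biUnion.1 hy
    obtain ⟨x, hx, rfl⟩ := Finset.mem_map.1 hy
    exact (rbt_zero_iff (fun x => a (e i x)) (X i)).1
      (fun v hv => h0 (i, v) (Finset.mem_filter.1 hv).2) x hx
  have hZcard : Z.card = ∑ i, (incidentEdges (X i)).card := by
    rw [Finset.card_biUnion]
    · simp
    · intro i _ j _ hij
      refine (hdisj i j hij).mono ?_ ?_ <;>
      · intro y hy
        obtain ⟨x, -, rfl⟩ := Finset.mem_map.1 hy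
        exact Subtype.property _
  have hinc : ∀ i, (incidentEdges (X i)).card + (α + 1 - (X i).card).choose 2
      = localScalarLength α := fun i => by
    rw [card_incidentEdges]
    exact sum_range_sub_add_choose α _ (hXle i)
  have hsum : Z.card + ∑ i, (α + 1 - (X i).card).choose 2 = m * localScalarLength α := by
    rw [hZcard, ← Finset.sum_add_distrib, Finset.sum_congr rfl fun i _ => hinc i]
    simp
  have hmiss : ∑ i, (α + 1 - (X i).card) + T.card = m * (α + 1) := by
    rw [card_eq_sum_fibers T, ← Finset.sum_add_distrib,
      Finset.sum_congr rfl fun i _ => Nat.sub_add_cancel (hXle i)]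
    simp
  have hcardn : Fintype.card (Fin m × Fin (α + 1)) = m * (α + 1) := by simp
  have hle := sum_choose_two_le (n := α + 1) (fun i => α + 1 - (X i).card)
    (fun i => Nat.sub_le _ _) Finset.univ (m - (l + 1)) (δ - 1) (by omega) (by omega)
  have hK := localDim_add_choose (α := α) (r := r) (by omega)
  rw [show α + 1 - r = δ - 1 by omega] at hK
  have hm : m * localScalarLength α = (m - (l + 1)) * localScalarLength α
      + l * localScalarLength α + localScalarLength α := by
    conv_lhs => rw [show m = (m - (l + 1)) + l + 1 by omega]
    ring
  change _ ≤ (m - (l + 1)) * localScalarLength α + _ at hle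
  have := hdet a ha Z (by omega) hZ0
  rw [this]
  rfl

/-- The scalars in `l` whole groups and `r - 1` nodes of another have rank below `(l + 1) K_L`, so a
nonzero codeword vanishes on all these nodes. -/
theorem minDist_rbtConstruction_le [Fintype ι] {A : Submodule F (ι → F)} {S : Fin m → Finset ι} {l δ E : ℕ}
    (e : ∀ i, Edge α ≃ S i) (hcover : Finset.univ.biUnion S = Finset.univ)
    (hr : 1 ≤ r) (hrα : r ≤ α) (hrδ : r + δ = α + 2) (hlm : l + 1 ≤ m)
    (hcard : ∀ i, (S i).card ≤ localDim α r + E)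
    (hS : ∀ i, ((E + 1 : ℕ) : ℕ∞) ≤ minDist (puncture A (S i)))
    (hdim : finrank F A = (l + 1) * localDim α r) :
    minDist (rbtConstruction A S e) ≤ (((m - (l + 1)) * (α + 1) + δ : ℕ) : ℕ∞) := by
  obtain ⟨I, -, hI⟩ := Finset.exists_subset_card_eq (s := (Finset.univ : Finset (Fin m)))
    (n := l) (by rw [Finset.card_univ, Fintype.card_fin]; omega)
  obtain ⟨i₀, hi₀⟩ : ∃ i, i ∉ I := by
    by_contra h
    push Not at h
    rw [Finset.eq_univ_iff_forall.2 h, Finset.card_univ, Fintype.card_fin] at hI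
    omega
  obtain ⟨X, -, hX⟩ := Finset.exists_subset_card_eq
    (s := (Finset.univ : Finset (Fin (α + 1)))) (n := r - 1)
    (by rw [Finset.card_univ, Fintype.card_fin]; omega)
  have h1 := finrank_biUnion_le (A := A) S hcard hS I
  have h2 := puncture_finrank_union_le A (I.biUnion S)
    ((incidentEdges X).map (edgeEmbedding (e i₀)))
  rw [Finset.card_map, card_incidentEdges, hX] at h2
  have h3 := sum_lt_localDim (s := r - 1) (by omega) hrα
  have h4 := puncture_finrank_eq_self (T := Finset.univ) A
    fun a _ h => funext fun i => h i (Finset.mem_univ i)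
  rw [hdim, add_mul, one_mul] at h4
  rw [hI] at h1
  obtain ⟨a, ha, h0, y, -, hy⟩ := exists_of_puncture_finrank_lt
    (T := I.biUnion S ∪ (incidentEdges X).map (edgeEmbedding (e i₀))) (U := Finset.univ) (A := A)
    (by omega)
  refine minDist_le_of_exists (mem_rbtConstruction.2 ⟨a, ha, rfl⟩)
    (fun h => hy (congrFun (eq_zero_of_rbt e hcover h) y))
    (I ×ˢ Finset.univ ∪ ({i₀} : Finset (Fin m)) ×ˢ X) ?_ ?_
  · rw [Finset.card_union_of_disjoint, Finset.card_product, Finset.card_product, hI, hX,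
      Finset.card_singleton, Finset.card_univ, Fintype.card_prod, Fintype.card_fin,
      Fintype.card_fin]
    · have hm : m * (α + 1) = (m - (l + 1)) * (α + 1) + l * (α + 1) + (α + 1) := by
        conv_lhs => rw [show m = (m - (l + 1)) + l + 1 by omega]
        ring
      omega
    · refine Finset.disjoint_left.2 fun p hp hp' => hi₀ ?_
      rw [Finset.mem_product] at hp hp'
      rw [← Finset.mem_singleton.1 hp'.1]
      exact hp.1
  · rintro ⟨i, v⟩ hp
    rcases Finset.mem_union.1 hp with hp | hp
    · funext j
      exact h0 _ (Finset.mem_union_left _ (Finset.mem_biUnion.2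
        ⟨i, (Finset.mem_product.1 hp).1, (e i (edge v j)).2⟩))
    · rw [Finset.mem_product, Finset.mem_singleton] at hp
      obtain ⟨rfl, hv⟩ := hp
      exact (rbt_zero_iff (fun x => a (e i x)) X).2 (fun x hx => h0 _ (Finset.mem_union_right _
        (Finset.mem_map_of_mem (edgeEmbedding (e i)) hx))) v hv

end Construction

/-! ### Consequences of optimality -/

section Optimal

variable {F : Type*} [Field F]

/-- An optimal scalar code whose local dimension divides its dimension is determined by any
`(ℓ - 1) N + K` of its coordinates. -/
theorem eq_zero_of_isOptimal {ι : Type*} [Fintype ι] [DecidableEq ι] {A : Submodule F (ι → F)}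
    {K E l : ℕ} (hK : 1 ≤ K)
    (hdim : finrank F A = (l + 1) * K) (hopt : IsOptimalAllSymbol A K (E + 1)) :
    ∀ a ∈ A, ∀ T : Finset ι, l * (K + E) + K ≤ T.card → (∀ i ∈ T, a i = 0) → a = 0 := by
  intro a ha T hT h0
  obtain ⟨-, d, hd, hdeq⟩ := hopt
  have hKq : (K : ℚ) ≠ 0 := by exact_mod_cast (by omega : K ≠ 0)
  -- The ceiling is exact because `K` divides the dimension; the distance is then `N - (l + 1) K + 1
  -- - l E`.
  have hceil : ⌈(finrank F A : ℚ) / (K : ℚ)⌉ = (l : ℤ) + 1 := by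
    rw [hdim]
    push_cast
    rw [mul_div_cancel_right₀ _ hKq]
    exact_mod_cast Int.ceil_intCast ((l : ℤ) + 1)
  rw [hceil, hdim] at hdeq
  refine (le_minDist_iff A d).1 hd.ge a ha T ?_ h0
  zify at hT ⊢
  rw [hdeq]
  push_cast
  linarith

theorem exists_local_mem {ι κ : Type*} [Fintype ι] [DecidableEq ι] [Fintype κ]
    {A : Submodule F (ι → F)} {K E : ℕ} {S : κ → Finset ι}
    (h : HasAllSymbolLocality A K (E + 1) S) (i : ι) :
    ∃ T : Finset ι, i ∈ T ∧ T.card ≤ K + E ∧ ((E + 1 : ℕ) : ℕ∞) ≤ minDist (puncture A T) := by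
  obtain ⟨k, -, hk⟩ := Finset.mem_biUnion.1 (h.2 ▸ Finset.mem_univ i)
  exact ⟨S k, hk, h.1.card_le k, h.1.le_minDist k⟩

theorem finrank_puncture_univ {V ι : Type*} [AddCommGroup V] [Module F V] [FiniteDimensional F V]
    [Fintype ι] (C : Submodule F (ι → V)) : finrank F (puncture C Finset.univ) = finrank F C :=
  finrank_map_eq_self C _ fun _ _ h => funext fun i =>
    (restrict_eq_zero_iff (F := F) _ _).1 h i (Finset.mem_univ i)

end Optimal

end LocalCodes

/-! ### Assembly of the theorem -/

theorem mainTheorem10 {F : Type*} [Field F] [Finite F] (r δ α m ℓ : ℕ)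
    (hr : 1 ≤ r) (hδ : 2 ≤ δ) (hα : α + 1 = r + δ - 1) (hℓ : 1 ≤ ℓ) (hℓm : ℓ ≤ m)
    (A : Submodule F (Fin (m * LocalCodes.localScalarLength α) → F))
    (hdim : Module.finrank F A = ℓ * LocalCodes.localDim α r)
    (hopt : LocalCodes.IsOptimalAllSymbol A
      (LocalCodes.localDim α r) (LocalCodes.localScalarDist α r)) :
    -- `A` is composed of `m` support-disjoint local codes
    (∃ S : Fin m → Finset (Fin (m * LocalCodes.localScalarLength α)),
      LocalCodes.IsLocalPartition A
        (LocalCodes.localDim α r) (LocalCodes.localScalarDist α r) S) ∧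
    -- and, whenever `A` is decomposed in this way,
    ∀ S : Fin m → Finset (Fin (m * LocalCodes.localScalarLength α)),
      LocalCodes.IsLocalPartition A
        (LocalCodes.localDim α r) (LocalCodes.localScalarDist α r) S →
      -- the local codes are `[N_L, K_L, Δ_L]` MDS codes,
      (∀ i, (S i).card = LocalCodes.localScalarLength α ∧
        LocalCodes.IsMDS (LocalCodes.puncture A (S i)) (LocalCodes.localDim α r) ∧
        LocalCodes.minDist (LocalCodes.puncture A (S i)) = LocalCodes.localScalarDist α r) ∧
      -- and the vector code `C` built on them has the asserted properties.
      ∀ (e : ∀ i, LocalCodes.Edge α ≃ S i)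
        (C : Submodule F (Fin m × Fin (α + 1) → Fin α → F)),
        C = LocalCodes.rbtConstruction A S e →
        LocalCodes.IsMBRLocalAllSymbol C r δ α 1 (LocalCodes.localDim α r)
          (LocalCodes.nodeGroup α m) ∧
        (∀ i j, i ≠ j →
          Disjoint (LocalCodes.nodeGroup α m i) (LocalCodes.nodeGroup α m j)) ∧
        (∀ i, LocalCodes.IsRBT
          (LocalCodes.puncture C (LocalCodes.nodeGroup α m i)) r) ∧
        Fintype.card (Fin m × Fin (α + 1)) = m * (r + δ - 1) ∧
        Module.finrank F C = ℓ * LocalCodes.localDim α r ∧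
        LocalCodes.minDist C = (((m - ℓ) * (r + δ - 1) + δ : ℕ) : ℕ∞) ∧
        (((m - ℓ) * (r + δ - 1) + δ : ℕ) : ℚ) =
          ((m * (r + δ - 1) : ℕ) : ℚ)
            - (Module.finrank F C : ℚ) / (LocalCodes.localDim α r : ℚ) * r + 1
            - ((Module.finrank F C : ℚ) / (LocalCodes.localDim α r : ℚ) - 1) * ((δ : ℚ) - 1) ∧
        LocalCodes.MeetsURABound C r δ (LocalCodes.mbrProfile α r)
          (LocalCodes.nodeGroup α m) := by
  classical
  obtain ⟨l, rfl⟩ : ∃ l, ℓ = l + 1 := ⟨ℓ - 1, by omega⟩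
  have hrα : r ≤ α := by omega
  have hrδ : r + δ = α + 2 := by omega
  have hKα := LocalCodes.one_le_localDim hr hrα
  have hK : 1 ≤ LocalCodes.localDim α r := by omega
  obtain ⟨E, hE⟩ : ∃ E, LocalCodes.localScalarLength α = LocalCodes.localDim α r + E :=
    ⟨_, (LocalCodes.localDim_add_choose (by omega)).symm⟩
  have hΔ : LocalCodes.localScalarDist α r = E + 1 := by
    rw [LocalCodes.localScalarDist, hE, Nat.add_sub_cancel_left]
  have hι : Fintype.card (Fin (m * LocalCodes.localScalarLength α))
      = m * (LocalCodes.localDim α r + E) := by rw [Fintype.card_fin, hE]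
  rw [hΔ] at hopt ⊢
  have hdet := LocalCodes.eq_zero_of_isOptimal hK hdim hopt
  obtain ⟨⟨t, S₀, hS₀⟩, -⟩ := hopt
  have hloc := LocalCodes.exists_local_mem hS₀
  refine ⟨?_, fun S hS => ?_⟩
  · obtain ⟨S, hcard, hd, hdisj, hcover⟩ :=
      LocalCodes.exists_local_partition hK hι hdim hdet hloc
    exact ⟨S, ⟨⟨fun i => (hcard i).le, hd, by
      rw [hcover, LocalCodes.finrank_puncture_univ]⟩, hcover⟩, hdisj⟩
  obtain ⟨⟨⟨hcard_le, hd, -⟩, hcover⟩, hdisj⟩ := hS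
  have hcard := LocalCodes.card_eq_of_partition hι S hcard_le hdisj hcover
  have hmds := fun i => LocalCodes.isMDS_of_local hK hdim hdet hloc (hcard i) (hd i)
  refine ⟨fun i => ⟨by rw [hcard i, hE], hmds i⟩, ?_⟩
  rintro e C rfl
  have hB := fun i => LocalCodes.isMDS_edgeCode (e i) (hmds i).1
  have hgroup := LocalCodes.puncture_rbtConstruction A S e
  have hmbr : ∀ i, LocalCodes.IsMBR
      (LocalCodes.puncture (LocalCodes.rbtConstruction A S e) (LocalCodes.nodeGroup α m i))
      (r + δ - 1) r α 1 (LocalCodes.localDim α r) := fun i => by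
    rw [hgroup i, ← hα]
    exact LocalCodes.isMBR_rbtCode (hB i) hr hrα _
  have hexact : LocalCodes.HasExactInfoLocality (LocalCodes.rbtConstruction A S e) r δ
      (LocalCodes.nodeGroup α m) := by
    refine ⟨fun i => by rw [LocalCodes.card_nodeGroup, hα], fun i => ?_, ?_⟩
    · rw [hgroup i]
      exact LocalCodes.minDist_rbtCode (hB i) hr hrα _ hrδ
    · rw [LocalCodes.biUnion_nodeGroup, LocalCodes.finrank_puncture_univ]
  have hfin : Module.finrank F (LocalCodes.rbtConstruction A S e)
      = (l + 1) * LocalCodes.localDim α r := by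
    rw [LocalCodes.finrank_rbtConstruction A e hcover, hdim]
  have hmin : LocalCodes.minDist (LocalCodes.rbtConstruction A S e)
      = (((m - (l + 1)) * (r + δ - 1) + δ : ℕ) : ℕ∞) := by
    rw [← hα]
    exact le_antisymm
      (LocalCodes.minDist_rbtConstruction_le e hcover hr hrα hrδ hℓm hcard_le hd hdim)
      (LocalCodes.le_minDist_rbtConstruction e hdisj hr hrδ (by omega) hℓm
        fun a ha T hT => hdet a ha T (by rwa [← hE]))
  -- Writing `m = ℓ + k` removes the truncated subtraction `m - ℓ` before passing to `ℚ` and `ℤ`.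
  obtain ⟨k, rfl⟩ := Nat.exists_eq_add_of_le hℓm
  refine ⟨⟨?_, hexact, hmbr, LocalCodes.biUnion_nodeGroup α _⟩,
    fun i j => LocalCodes.disjoint_nodeGroup α _, fun i => ⟨_, _, hB i, hgroup i⟩, ?_, hfin, hmin,
    ?_, hexact, ?_, _, hmin, ?_⟩
  · exact LocalCodes.isVectorCode_of_puncture (LocalCodes.nodeGroup α _)
      (fun p => ⟨p.1, by simp [LocalCodes.nodeGroup]⟩) fun i => (hmbr i).regenerating.vectorCode
  · rw [Fintype.card_prod, Fintype.card_fin, Fintype.card_fin, hα]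
  · have hKq : (LocalCodes.localDim α r : ℚ) ≠ 0 := by
      exact_mod_cast (by omega : LocalCodes.localDim α r ≠ 0)
    have hrδq : (r : ℚ) + δ = α + 2 := by exact_mod_cast hrδ
    rw [hfin, ← hα, Nat.add_sub_cancel_left]
    push_cast
    rw [mul_div_cancel_right₀ _ hKq]
    linear_combination ((l : ℚ) + 1) * hrδq
  · intro i
    rw [hgroup i]
    exact LocalCodes.isURA_rbtCode (hB i) (by omega) _
  · have hrδz : (r : ℤ) + δ = α + 2 := by exact_mod_cast hrδ
    rw [hfin, ← hα, LocalCodes.leadingSumInv_mbrProfile hr hrα, Fintype.card_prod,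
      Fintype.card_fin, Fintype.card_fin, Nat.add_sub_cancel_left]
    push_cast
    linear_combination hrδz
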